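/- Let $G$ be a finite simple plane graph, not necessarily connected, with minimum degree $5$ and with no vertex of degree $7$ and no vertex of degree $8$. For $\kappa_1,\dots,\kappa_5 \in \{1,2,3,\dots\}\cup\{\infty\}$, a $\langle \kappa_1,\kappa_2,\kappa_3,\kappa_4,\kappa_5\rangle$-star in $G$ is a vertex of degree $5$ (the center) together with its five neighbors, such that these neighbors, listed in the cyclic order in which the edges leave the center in the plane (clockwise or counterclockwise, starting with any of them), have degrees in $G$ at most $\kappa_1,\kappa_2,\kappa_3,\kappa_4,\kappa_5$, respectively. Then $G$ contains at least one of the following seven kinds of stars: a $\langle 5,6,6,5,\infty\rangle$-star, a $\langle 5,6,6,6,17\rangle$-star, a $\langle 6,6,6,6,11\rangle$-star, a $\langle 5,6,9,5,10\rangle$-star, a $\langle 5,6,11,5,9\rangle$-star, a $\langle 5,5,10,5,12\rangle$-star, or a $\langle 5,5,9,5,17\rangle$-star. -/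

import Mathlib

namespace SimpleGraph

/-- A rotation system on a simple graph `G`, i.e. an embedding of `G` in an oriented surface up to
homeomorphism: at every vertex `v` a cyclic order of the edges around `v`. A dart `d` with
`d.fst = v` is an edge at `v` directed away from `v`, and `rot d` is the next one around `v`. -/
structure RotationSystem {V : Type*} (G : SimpleGraph V) where
  /-- the successor of a dart in the cyclic order around its initial vertex -/
  rot : Equiv.Perm G.Dart
  rot_fst : ∀ d : G.Dart, (rot d).fst = d.fst
  /-- the darts that start at a given vertex form one cycle of `rot` -/
  rot_sameCycle : ∀ d e : G.Dart, d.fst = e.fst → rot.SameCycle d e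

namespace RotationSystem

variable {V : Type*} {G : SimpleGraph V} (R : G.RotationSystem)

/-- The successor of a dart `d` along the boundary walk of the face beside `d`: traverse `d`, then
leave its end vertex along the edge that follows `d` in the cyclic order there. -/
def faceNext : Equiv.Perm G.Dart :=
  (Function.Involutive.toPerm (Dart.symm : G.Dart → G.Dart) Dart.symm_involutive).trans R.rot

/-- The facial walks: the cycles of `faceNext`, and one trivial facial walk for every isolated
vertex. -/
def FacialWalk : Type _ :=
  Quotient (Equiv.Perm.SameCycle.setoid R.faceNext) ⊕ {v : V // ∀ w : V, ¬ G.Adj v w}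

/-- The Euler characteristic of the closed surface obtained by gluing a disc to every facial walk.
This surface has one component for each component of `G`. -/
noncomputable def eulerChar : ℤ :=
  (Nat.card V : ℤ) - Nat.card G.edgeSet + Nat.card R.FacialWalk

/-- `R` describes an embedding of the finite graph `G` in the plane: each component of `G` is
embedded with genus zero. (A component of genus `g` contributes `2 - 2 * g ≤ 2` to the Euler
characteristic, so that the equation forces `g = 0` for every component.) -/
def IsPlane : Prop :=
  R.eulerChar = 2 * (Nat.card G.ConnectedComponent : ℤ)

/-- The embedded graph contains a `⟨κ 0, κ 1, κ 2, κ 3, κ 4⟩`-star: a vertex of degree five whose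
neighbours, listed in a cyclic order around it (clockwise or counterclockwise, from any starting
point), have degrees at most `κ 0, …, κ 4`. The centre is `d.fst`, and the list starts with the
neighbour `d.snd`. A bound `⊤` is no restriction. -/
def HasMinorFiveStar [Fintype V] [DecidableRel G.Adj] (κ : Fin 5 → ℕ∞) : Prop :=
  ∃ d : G.Dart, G.degree d.fst = 5 ∧
    ((∀ i : Fin 5, (G.degree ((R.rot ^ (i : ℕ)) d).snd : ℕ∞) ≤ κ i) ∨
      (∀ i : Fin 5, (G.degree ((R.rot⁻¹ ^ (i : ℕ)) d).snd : ℕ∞) ≤ κ i))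

end RotationSystem

end SimpleGraph

/-! The proof is by discharging, in units of 1/60. A vertex of degree `d` starts with `60 * d - 360`
and a facial walk of length `l` with `120 * l - 360`. By Euler's formula the total is `-360` times
the Euler characteristic, hence negative for a nonempty plane graph. If none of the seven stars
occurs, the charge can be moved so that nothing ends up negative, a contradiction.

Only vertices of degree five start negative, at `-60`. Each corner of a nontriangular face gives 30
to its vertex, which a walk of length at least four can afford. A vertex of degree at least nine
gives to its neighbours of degree five according to `gift`. For most degrees the rule is an equal
share for every neighbour, where the share of a neighbour not of degree five is split between the
two neighbours beside it. Degrees 11 and 13 cannot afford shares of 30 and 33 for all neighbours.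
They are rescued by parity: if all neighbours have degree five, the far vertices of the surrounding
triangles would have to alternate between small and large, which an odd cycle forbids
(`exists_saturated_or_nontriangular`). The exception is a receiver that needs nothing from this
giver, or two consecutive receivers with face charge. The upper bound on giving is
`sum_giftAlong_le`.

On the receiving side (`sixty_le_received_or_deficientSeq`) the forbidden patterns yield 60 in every
case but one: the neighbourhood 5, 5, A, 5, 10 with A equal to 13 or 14 and all corners triangular
may yield only 33 + 24 = 57. Such a vertex borrows 3 from one of its two consecutive neighbours of
degree five. A lender has received at least 66 (`le_received_of_asks`), and the position of its
debtors limits their number to two (`sum_runEnd_le`), so it can afford every loan.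

The statements about vertices and faces are `vertex_balance` and `face_balance`; summed, they force
a nonpositive Euler characteristic. -/

namespace MinorStar

/-! ### The discharging rule for large vertices -/

/-- The number of triangular corners next to a spoke whose far end has degree at least six. -/
def sides (x₁ x₄ : ℕ) (r l : Bool) : ℕ :=
  (if r = true ∧ 6 ≤ x₁ then 1 else 0) + (if l = true ∧ 6 ≤ x₄ then 1 else 0)

/-- Both vertices next to the giver have degree five, and the two opposite ones are large. -/
def Saturated (x₁ x₂ x₃ x₄ : ℕ) : Prop := x₁ ≤ 5 ∧ x₄ ≤ 5 ∧ 9 ≤ x₂ ∧ 9 ≤ x₃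

instance (x₁ x₂ x₃ x₄ : ℕ) : Decidable (Saturated x₁ x₂ x₃ x₄) := by
  unfold Saturated; infer_instance

/-- The gift of a vertex of degree eleven. -/
def giftEleven (x₁ x₂ x₃ x₄ : ℕ) (al : Bool) : ℕ :=
  if Saturated x₁ x₂ x₃ x₄ then 0
  else if al = false then 15
  -- In the cyclic pattern 11, 5, 10, x₃, x₄ the 10-vertex gives 36 if `x₃` is 6 and 24 if `x₃` is
  -- 5; the gifts 24 and 36 here complete this to 60. When `x₃` and `x₄` are both 5 the star is
  -- forbidden, so that value is immaterial.
  else if x₁ ≤ 5 ∧ x₂ = 10 ∧ x₃ ≤ 8 ∧ x₄ ≤ 8 then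
    (if 6 ≤ x₃ then 24 else if 6 ≤ x₄ then 36 else 30)
  else if x₄ ≤ 5 ∧ x₃ = 10 ∧ x₂ ≤ 8 ∧ x₁ ≤ 8 then
    (if 6 ≤ x₂ then 24 else if 6 ≤ x₁ then 36 else 30)
  else 30

/-- The gift of a vertex of degree thirteen or fourteen. -/
def giftThirteen (x₁ x₂ x₃ x₄ : ℕ) (r l al : Bool) : ℕ :=
  if Saturated x₁ x₂ x₃ x₄ then 0
  -- Two gifts of 33 make the 66 that a lender needs. Thirteen of them exceed the charge 420 of a
  -- 13-vertex by 9, and two reductions to 27 save 12.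
  else if sides x₁ x₄ r l = 0 then (if al = true then 33 else 27)
  else if sides x₁ x₄ r l = 1 then 40
  else 60

/-- The charge, in units of `1/60`, that a vertex of degree `d` gives to an adjacent vertex of
degree five, the other neighbours of which have degrees `x₁, x₂, x₃, x₄` in cyclic order. The
flags tell whether the corners on the two sides of the edge, and all corners at the receiver, are
triangular. -/
def gift (d x₁ x₂ x₃ x₄ : ℕ) (r l al : Bool) : ℕ :=
  if d ≤ 8 then 0
  else if d = 9 then 20 + 10 * sides x₁ x₄ r l
  else if d = 10 then 24 + 12 * sides x₁ x₄ r l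
  else if d = 11 then giftEleven x₁ x₂ x₃ x₄ al
  else if d = 12 then 30 + 15 * sides x₁ x₄ r l
  else if d ≤ 14 then giftThirteen x₁ x₂ x₃ x₄ r l al
  else if d ≤ 17 then 36 + 18 * sides x₁ x₄ r l
  else 40 + 20 * sides x₁ x₄ r l

lemma sides_comm (x₁ x₄ : ℕ) (r l : Bool) : sides x₁ x₄ r l = sides x₄ x₁ l r := by
  unfold sides; omega

lemma saturated_comm (x₁ x₂ x₃ x₄ : ℕ) : Saturated x₁ x₂ x₃ x₄ ↔ Saturated x₄ x₃ x₂ x₁ := by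
  unfold Saturated; omega

lemma giftEleven_comm (x₁ x₂ x₃ x₄ : ℕ) (al : Bool) :
    giftEleven x₁ x₂ x₃ x₄ al = giftEleven x₄ x₃ x₂ x₁ al := by
  unfold giftEleven
  by_cases hs : Saturated x₁ x₂ x₃ x₄
  · rw [if_pos hs, if_pos ((saturated_comm ..).1 hs)]
  · rw [if_neg hs, if_neg (fun h => hs ((saturated_comm ..).2 h))]
    cases al
    · simp
    · simp only [Bool.true_eq_false, if_false]
      by_cases h : x₁ ≤ 5 ∧ x₂ = 10 ∧ x₃ ≤ 8 ∧ x₄ ≤ 8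
      · have h' : ¬ (x₄ ≤ 5 ∧ x₃ = 10 ∧ x₂ ≤ 8 ∧ x₁ ≤ 8) := by omega
        simp only [if_pos h, if_neg h']
      · rw [if_neg h]
        by_cases h' : x₄ ≤ 5 ∧ x₃ = 10 ∧ x₂ ≤ 8 ∧ x₁ ≤ 8
        · simp only [if_pos h', if_neg h]
        · simp only [if_neg h', if_neg h]

lemma giftThirteen_comm (x₁ x₂ x₃ x₄ : ℕ) (r l al : Bool) :
    giftThirteen x₁ x₂ x₃ x₄ r l al = giftThirteen x₄ x₃ x₂ x₁ l r al := by
  unfold giftThirteen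
  rw [sides_comm x₁ x₄ r l]
  by_cases hs : Saturated x₁ x₂ x₃ x₄
  · rw [if_pos hs, if_pos ((saturated_comm ..).1 hs)]
  · rw [if_neg hs, if_neg (fun h => hs ((saturated_comm ..).2 h))]

lemma gift_comm (d x₁ x₂ x₃ x₄ : ℕ) (r l al : Bool) :
    gift d x₁ x₂ x₃ x₄ r l al = gift d x₄ x₃ x₂ x₁ l r al := by
  unfold gift
  rw [sides_comm x₁ x₄ r l, giftEleven_comm, giftThirteen_comm]

lemma gift_of_le {d : ℕ} (h : d ≤ 8) (x₁ x₂ x₃ x₄ : ℕ) (r l al : Bool) :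
    gift d x₁ x₂ x₃ x₄ r l al = 0 := by
  simp [gift, h]

lemma le_gift {d x₁ x₂ x₃ x₄ : ℕ} {r l al : Bool} (h : 9 ≤ d) (hZ : ¬ Saturated x₁ x₂ x₃ x₄) :
    15 ≤ gift d x₁ x₂ x₃ x₄ r l al := by
  unfold gift giftThirteen giftEleven
  split_ifs <;> omega

lemma le_gift_of_all {d x₁ x₂ x₃ x₄ : ℕ} {r l : Bool} (h : 9 ≤ d)
    (hZ : ¬ Saturated x₁ x₂ x₃ x₄) : 20 ≤ gift d x₁ x₂ x₃ x₄ r l true := by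
  unfold gift giftThirteen giftEleven
  split_ifs <;> first | omega | contradiction

lemma one_le_sides {x₁ x₄ : ℕ} {l : Bool} (hx : 6 ≤ x₁) : 1 ≤ sides x₁ x₄ true l := by
  simp [sides, hx]

lemma le_gift_of_large_side {d x₁ x₂ x₃ x₄ : ℕ} {l : Bool} (h : 9 ≤ d) (hx : 9 ≤ x₁) :
    30 ≤ gift d x₁ x₂ x₃ x₄ true l true := by
  have hs := one_le_sides (x₄ := x₄) (l := l) (show 6 ≤ x₁ by omega)
  have hZ : ¬ Saturated x₁ x₂ x₃ x₄ := fun h => by unfold Saturated at h; omega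
  have h11 : giftEleven x₁ x₂ x₃ x₄ true = 30 := by
    unfold giftEleven
    rw [if_neg hZ, if_neg (by decide), if_neg (by omega), if_neg (by omega)]
  have h13 : 30 ≤ giftThirteen x₁ x₂ x₃ x₄ true l true := by
    unfold giftThirteen
    rw [if_neg hZ]
    split_ifs <;> omega
  unfold gift
  split_ifs <;> omega

lemma le_gift_of_large_side' {d x₁ x₂ x₃ x₄ : ℕ} {r : Bool} (h : 9 ≤ d) (hx : 9 ≤ x₄) :
    30 ≤ gift d x₁ x₂ x₃ x₄ r true true := by
  rw [gift_comm]; exact le_gift_of_large_side h hx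

/-! ### What a vertex of degree five receives -/

/-- The degrees `a, b, c, d, e` fit one of the seven patterns, read in this order. -/
def Light (a b c d e : ℕ) : Prop :=
  (a ≤ 5 ∧ b ≤ 6 ∧ c ≤ 6 ∧ d ≤ 5) ∨ (a ≤ 5 ∧ b ≤ 6 ∧ c ≤ 6 ∧ d ≤ 6 ∧ e ≤ 17) ∨
  (a ≤ 6 ∧ b ≤ 6 ∧ c ≤ 6 ∧ d ≤ 6 ∧ e ≤ 11) ∨ (a ≤ 5 ∧ b ≤ 6 ∧ c ≤ 9 ∧ d ≤ 5 ∧ e ≤ 10) ∨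
  (a ≤ 5 ∧ b ≤ 6 ∧ c ≤ 11 ∧ d ≤ 5 ∧ e ≤ 9) ∨ (a ≤ 5 ∧ b ≤ 5 ∧ c ≤ 10 ∧ d ≤ 5 ∧ e ≤ 12) ∨
  (a ≤ 5 ∧ b ≤ 5 ∧ c ≤ 9 ∧ d ≤ 5 ∧ e ≤ 17)

/-- The cyclic sequence `n` of degrees is admissible: no degree is below five or equal to seven or
eight, and it fits none of the seven patterns. -/
structure Admissible (n : Fin 5 → ℕ) : Prop where
  five_le : ∀ i, 5 ≤ n i
  ne_seven : ∀ i, n i ≠ 7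
  ne_eight : ∀ i, n i ≠ 8
  not_light : ∀ i, ¬ Light (n i) (n (i + 1)) (n (i + 2)) (n (i + 3)) (n (i + 4))
  not_light' : ∀ i, ¬ Light (n i) (n (i + 4)) (n (i + 3)) (n (i + 2)) (n (i + 1))

/-- All five corners are triangular. -/
def allTri (t : Fin 5 → Bool) : Bool := t 0 && t 1 && t 2 && t 3 && t 4

/-- What a vertex of degree five gets from its `i`-th neighbour. -/
def giftAt (n : Fin 5 → ℕ) (t : Fin 5 → Bool) (i : Fin 5) : ℕ :=
  gift (n i) (n (i + 1)) (n (i + 2)) (n (i + 3)) (n (i + 4)) (t i) (t (i + 4)) (allTri t)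

/-- What a vertex of degree five gets in total from its neighbours and incident faces. -/
def received (n : Fin 5 → ℕ) (t : Fin 5 → Bool) : ℕ :=
  ∑ i, giftAt n t i + ∑ i, (if t i = true then 0 else 30)

/-- The sequence `f`, started at `k`. -/
def shift {α : Type*} (k : Fin 5) (f : Fin 5 → α) : Fin 5 → α := fun i => f (i + k)

lemma Admissible.shift {n : Fin 5 → ℕ} (h : Admissible n) (k : Fin 5) :
    Admissible (shift k n) where
  five_le i := h.five_le _
  ne_seven i := h.ne_seven _
  ne_eight i := h.ne_eight _
  not_light i := by
    have := h.not_light (i + k)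
    simpa only [MinorStar.shift, add_right_comm] using this
  not_light' i := by
    have := h.not_light' (i + k)
    simpa only [MinorStar.shift, add_right_comm] using this

lemma allTri_eq_true {t : Fin 5 → Bool} : allTri t = true ↔ ∀ i, t i = true := by
  simp [allTri, Fin.forall_fin_succ, and_assoc]

lemma allTri_shift (k : Fin 5) (t : Fin 5 → Bool) : allTri (shift k t) = allTri t := by
  rw [Bool.eq_iff_iff, allTri_eq_true, allTri_eq_true]
  exact ⟨fun h i => by simpa [shift] using h (i - k), fun h i => h _⟩

lemma giftAt_shift (n : Fin 5 → ℕ) (t : Fin 5 → Bool) (k i : Fin 5) :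
    giftAt (shift k n) (shift k t) i = giftAt n t (i + k) := by
  simp only [giftAt, allTri_shift]
  simp only [shift, add_right_comm]

lemma received_shift (n : Fin 5 → ℕ) (t : Fin 5 → Bool) (k : Fin 5) :
    received (shift k n) (shift k t) = received n t := by
  unfold received
  congr 1
  · simp only [giftAt_shift]
    exact Equiv.sum_comp (Equiv.addRight k) (giftAt n t)
  · exact Equiv.sum_comp (Equiv.addRight k) (fun i => if t i = true then 0 else 30)

lemma giftAt_zero (n : Fin 5 → ℕ) (t : Fin 5 → Bool) :
    giftAt n t 0 = gift (n 0) (n 1) (n 2) (n 3) (n 4) (t 0) (t 4) (allTri t) := rfl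

lemma giftAt_one (n : Fin 5 → ℕ) (t : Fin 5 → Bool) :
    giftAt n t 1 = gift (n 1) (n 2) (n 3) (n 4) (n 0) (t 1) (t 0) (allTri t) := rfl

lemma giftAt_two (n : Fin 5 → ℕ) (t : Fin 5 → Bool) :
    giftAt n t 2 = gift (n 2) (n 3) (n 4) (n 0) (n 1) (t 2) (t 1) (allTri t) := rfl

lemma giftAt_three (n : Fin 5 → ℕ) (t : Fin 5 → Bool) :
    giftAt n t 3 = gift (n 3) (n 4) (n 0) (n 1) (n 2) (t 3) (t 2) (allTri t) := rfl

lemma giftAt_four (n : Fin 5 → ℕ) (t : Fin 5 → Bool) :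
    giftAt n t 4 = gift (n 4) (n 0) (n 1) (n 2) (n 3) (t 4) (t 3) (allTri t) := rfl

lemma giftAt_add_le_received (n : Fin 5 → ℕ) (t : Fin 5 → Bool) {i j : Fin 5} (h : i ≠ j) :
    giftAt n t i + giftAt n t j + ∑ k, (if t k = true then 0 else 30) ≤ received n t := by
  unfold received
  rw [← Finset.sum_pair h (f := giftAt n t)]
  gcongr
  exact Finset.subset_univ _

lemma le_sum_of_not_allTri {t : Fin 5 → Bool} (h : allTri t = false) :
    30 ≤ ∑ k, (if t k = true then 0 else 30) := by
  have : ¬ ∀ i, t i = true := by rw [← allTri_eq_true, h]; decide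
  push Not at this
  obtain ⟨i, hi⟩ := this
  calc 30 = if t i = true then 0 else 30 := by rw [if_neg hi]
    _ ≤ _ := Finset.single_le_sum (f := fun k => if t k = true then 0 else 30)
      (fun _ _ => Nat.zero_le _) (Finset.mem_univ i)

/-- `1` if `k` is the degree of a large vertex, and `0` otherwise. -/
def large (k : ℕ) : ℕ := if 9 ≤ k then 1 else 0

lemma large_of_le {k : ℕ} (h : 9 ≤ k) : large k = 1 := if_pos h

lemma large_of_lt {k : ℕ} (h : k ≤ 8) : large k = 0 := if_neg (by omega)

lemma lt_of_large_eq_zero {k : ℕ} (h : large k = 0) : k ≤ 8 := by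
  by_contra hk
  rw [large_of_le (by omega)] at h
  exact absurd h one_ne_zero

/-- The number of large neighbours. -/
def numLarge (n : Fin 5 → ℕ) : ℕ :=
  large (n 0) + large (n 1) + large (n 2) + large (n 3) + large (n 4)

def SaturatedAt (n : Fin 5 → ℕ) (i : Fin 5) : Prop :=
  Saturated (n (i + 1)) (n (i + 2)) (n (i + 3)) (n (i + 4))

/-- This is why a saturated giver may withhold its gift: the two opposite large neighbours are
adjacent in the cyclic order and already suffice, with 30 + 30 if all corners are triangular and
with 15 + 15 + 30 otherwise. -/
lemma received_of_saturatedAt {n : Fin 5 → ℕ} {t : Fin 5 → Bool} {i : Fin 5}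
    (h : SaturatedAt n i) : 60 ≤ received n t := by
  rw [← received_shift n t i]
  have h0 : Saturated (shift i n 1) (shift i n 2) (shift i n 3) (shift i n 4) := by
    simpa only [SaturatedAt, shift, add_comm] using h
  generalize shift i n = m at *
  generalize shift i t = s at *
  obtain ⟨h1, h4, h2, h3⟩ := h0
  have key := giftAt_add_le_received m s (show (2 : Fin 5) ≠ 3 by decide)
  rw [giftAt_two, giftAt_three] at key
  cases hal : allTri s
  · have := le_sum_of_not_allTri hal
    have h5 := le_gift h2 (x₁ := m 3) (x₂ := m 4) (x₃ := m 0) (x₄ := m 1) (r := s 2) (l := s 1)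
      (al := allTri s) (by unfold Saturated; omega)
    have h6 := le_gift h3 (x₁ := m 4) (x₂ := m 0) (x₃ := m 1) (x₄ := m 2) (r := s 3) (l := s 2)
      (al := allTri s) (by unfold Saturated; omega)
    omega
  · have ht := allTri_eq_true.1 hal
    rw [hal, ht 2, ht 1, ht 3] at key
    have h5 := le_gift_of_large_side (x₂ := m 4) (x₃ := m 0) (x₄ := m 1) (l := true) h2 h3
    have h6 := le_gift_of_large_side' (x₁ := m 4) (x₂ := m 0) (x₃ := m 1) (r := true) h3 h2
    omega

lemma le_giftAt {n : Fin 5 → ℕ} {t : Fin 5 → Bool} {i : Fin 5} (h : ¬ SaturatedAt n i) :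
    15 * large (n i) ≤ giftAt n t i := by
  unfold large
  split_ifs with hi
  · exact le_gift hi h
  · exact Nat.zero_le _

lemma le_giftAt_of_all {n : Fin 5 → ℕ} {t : Fin 5 → Bool} (hal : allTri t = true) {i : Fin 5}
    (h : ¬ SaturatedAt n i) : 20 * large (n i) ≤ giftAt n t i := by
  unfold large
  split_ifs with hi
  · unfold giftAt; rw [hal]; exact le_gift_of_all hi h
  · exact Nat.zero_le _

/-- Apart from the saturated case, every large neighbour gives at least 20 if all corners are
triangular, and otherwise at least 15 next to a face gift of 30. -/
lemma received_of_three_le {n : Fin 5 → ℕ} {t : Fin 5 → Bool} (h : 3 ≤ numLarge n) :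
    60 ≤ received n t := by
  by_cases hs : ∃ i, SaturatedAt n i
  · obtain ⟨i, hi⟩ := hs; exact received_of_saturatedAt hi
  push Not at hs
  unfold numLarge at h
  cases hal : allTri t
  · have h1 := le_sum_of_not_allTri hal
    have h2 := fun i => le_giftAt (t := t) (hs i)
    have := h2 0; have := h2 1; have := h2 2; have := h2 3; have := h2 4
    unfold received
    rw [Fin.sum_univ_five (giftAt n t)]
    omega
  · have h2 := fun i => le_giftAt_of_all hal (hs i)
    have := h2 0; have := h2 1; have := h2 2; have := h2 3; have := h2 4
    unfold received
    rw [Fin.sum_univ_five (giftAt n t)]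
    omega

lemma received_of_two_le_of_not_allTri {n : Fin 5 → ℕ} {t : Fin 5 → Bool}
    (h : 2 ≤ numLarge n) (hal : allTri t = false) : 60 ≤ received n t := by
  by_cases hs : ∃ i, SaturatedAt n i
  · obtain ⟨i, hi⟩ := hs; exact received_of_saturatedAt hi
  push Not at hs
  unfold numLarge at h
  have h1 := le_sum_of_not_allTri hal
  have h2 := fun i => le_giftAt (t := t) (hs i)
  have := h2 0; have := h2 1; have := h2 2; have := h2 3; have := h2 4
  unfold received
  rw [Fin.sum_univ_five (giftAt n t)]
  omega

lemma Admissible.le_six {n : Fin 5 → ℕ} (h : Admissible n) {i : Fin 5} (hi : n i ≤ 8) :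
    n i ≤ 6 := by
  have := h.ne_seven i
  have := h.ne_eight i
  omega

lemma Admissible.numLarge_pos {n : Fin 5 → ℕ} (h : Admissible n) : 1 ≤ numLarge n := by
  by_contra hc
  unfold numLarge at hc
  have s0 := h.le_six (lt_of_large_eq_zero (k := n 0) (by omega))
  have s1 := h.le_six (lt_of_large_eq_zero (k := n 1) (by omega))
  have s2 := h.le_six (lt_of_large_eq_zero (k := n 2) (by omega))
  have s3 := h.le_six (lt_of_large_eq_zero (k := n 3) (by omega))
  have s4 := h.le_six (lt_of_large_eq_zero (k := n 4) (by omega))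
  exact h.not_light 0 (Or.inr (Or.inr (Or.inl ⟨s0, s1, s2, s3, by simpa using s4.trans (by omega)⟩)))

lemma le_gift_of_one_le_sides {d x₁ x₂ x₃ x₄ : ℕ} {r l al : Bool} (h : 12 ≤ d)
    (hZ : ¬ Saturated x₁ x₂ x₃ x₄) (hs : 1 ≤ sides x₁ x₄ r l) :
    40 ≤ gift d x₁ x₂ x₃ x₄ r l al := by
  unfold gift giftThirteen
  rw [if_neg hZ]
  split_ifs <;> omega

lemma le_gift_of_sides_eq_two {d x₁ x₂ x₃ x₄ : ℕ} {r l al : Bool} (h : 12 ≤ d)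
    (hZ : ¬ Saturated x₁ x₂ x₃ x₄) (hs : sides x₁ x₄ r l = 2) :
    60 ≤ gift d x₁ x₂ x₃ x₄ r l al := by
  unfold gift giftThirteen
  rw [if_neg hZ]
  split_ifs <;> omega

lemma le_gift_of_eighteen_le {d x₁ x₂ x₃ x₄ : ℕ} {r l al : Bool} (h : 18 ≤ d) :
    40 + 20 * sides x₁ x₄ r l ≤ gift d x₁ x₂ x₃ x₄ r l al := by
  unfold gift
  split_ifs <;> omega

/-- A single large neighbour must supply nearly everything. The pattern 6, 6, 6, 6, 11 forces its
degree to be at least 12, the pattern 5, 6, 6, 5 forces a 6 beside it, and 5, 6, 6, 6, 17 forces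
either degree at least 18 or a 6 on both sides. So it gives 40 + 20 or two half shares on top of a
full one, when all corners are triangular. -/
lemma received_of_one {n : Fin 5 → ℕ} {t : Fin 5 → Bool} (h : Admissible n)
    (h1 : n 1 ≤ 8) (h2 : n 2 ≤ 8) (h3 : n 3 ≤ 8) (h4 : n 4 ≤ 8) :
    60 ≤ received n t := by
  have l1 : ¬ Light (n 1) (n 2) (n 3) (n 4) (n 0) := h.not_light 1
  have l2 : ¬ Light (n 4) (n 3) (n 2) (n 1) (n 0) := h.not_light' 4
  replace h1 := h.le_six h1
  replace h2 := h.le_six h2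
  replace h3 := h.le_six h3
  replace h4 := h.le_six h4
  have k12 : 12 ≤ n 0 := by unfold Light at l1; omega
  have k18 : 18 ≤ n 0 ∨ (6 ≤ n 1 ∧ 6 ≤ n 4) := by unfold Light at l1 l2; omega
  have k6 : 6 ≤ n 1 ∨ 6 ≤ n 4 := by unfold Light at l1; omega
  have hZ : ¬ Saturated (n 1) (n 2) (n 3) (n 4) := fun h => by unfold Saturated at h; omega
  have key : giftAt n t 0 + ∑ k, (if t k = true then 0 else 30) ≤ received n t := by
    have := giftAt_add_le_received n t (show (0 : Fin 5) ≠ 1 by decide)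
    omega
  rw [giftAt_zero] at key
  cases hal : allTri t
  · have hs := le_sum_of_not_allTri hal
    rcases k18 with k18 | ⟨k1, k4⟩
    · have := le_gift_of_eighteen_le (x₁ := n 1) (x₂ := n 2) (x₃ := n 3) (x₄ := n 4) (r := t 0)
        (l := t 4) (al := allTri t) k18
      omega
    -- If both corners beside the giver are nontriangular, the two faces alone give 60; otherwise
    -- one triangular side raises the gift to 40, and some face adds 30.
    · by_cases hc : t 0 = false ∧ t 4 = false
      · rw [Fin.sum_univ_five] at key
        simp only [hc.1, hc.2, Bool.false_eq_true, if_false] at key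
        omega
      · have hs1 : 1 ≤ sides (n 1) (n 4) (t 0) (t 4) := by
          unfold sides
          rcases hb : t 0 <;> rcases hb' : t 4 <;> simp_all
        have := le_gift_of_one_le_sides (al := allTri t) k12 hZ hs1
        omega
  · have ht := allTri_eq_true.1 hal
    rw [ht 0, ht 4] at key
    rcases k18 with k18 | ⟨k1, k4⟩
    · have := le_gift_of_eighteen_le (x₁ := n 1) (x₂ := n 2) (x₃ := n 3) (x₄ := n 4) (r := true)
        (l := true) (al := allTri t) k18
      have hs1 : 1 ≤ sides (n 1) (n 4) true true := by
        rcases k6 with k | k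
        · exact one_le_sides k
        · rw [sides_comm]; exact one_le_sides k
      omega
    · have := le_gift_of_sides_eq_two (al := allTri t) k12 hZ
        (show sides (n 1) (n 4) true true = 2 by simp [sides, k1, k4])
      omega

lemma received_of_adjacent {n : Fin 5 → ℕ} {t : Fin 5 → Bool}
    (h0 : 9 ≤ n 0) (h1 : 9 ≤ n 1) : 60 ≤ received n t := by
  cases hal : allTri t
  · refine received_of_two_le_of_not_allTri ?_ hal
    unfold numLarge
    rw [large_of_le h0, large_of_le h1]
    omega
  have key := giftAt_add_le_received n t (show (0 : Fin 5) ≠ 1 by decide)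
  have ht := allTri_eq_true.1 hal
  rw [giftAt_zero, giftAt_one, hal, ht 0, ht 1, ht 4] at key
  have h5 := le_gift_of_large_side (x₂ := n 2) (x₃ := n 3) (x₄ := n 4) (l := true) h0 h1
  have h6 := le_gift_of_large_side' (x₁ := n 2) (x₂ := n 3) (x₃ := n 4) (r := true) h1 h0
  omega

lemma le_gift_of_thirteen_le {d x₁ x₂ x₃ x₄ : ℕ} {r l al : Bool} (h : 13 ≤ d)
    (hZ : ¬ Saturated x₁ x₂ x₃ x₄) : (if al = true then 33 else 27) ≤ gift d x₁ x₂ x₃ x₄ r l al := by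
  unfold gift giftThirteen
  rw [if_neg hZ]
  cases al
  · simp only [Bool.false_eq_true, if_false]
    split_ifs <;> omega
  · simp only [if_true]
    split_ifs <;> omega

lemma gift_nine (x₁ x₂ x₃ x₄ : ℕ) (r l al : Bool) :
    gift 9 x₁ x₂ x₃ x₄ r l al = 20 + 10 * sides x₁ x₄ r l := by
  simp [gift]

lemma gift_ten (x₁ x₂ x₃ x₄ : ℕ) (r l al : Bool) :
    gift 10 x₁ x₂ x₃ x₄ r l al = 24 + 12 * sides x₁ x₄ r l := by
  simp [gift]

lemma gift_eleven (x₁ x₂ x₃ x₄ : ℕ) (r l al : Bool) :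
    gift 11 x₁ x₂ x₃ x₄ r l al = giftEleven x₁ x₂ x₃ x₄ al := by
  simp [gift]

lemma gift_twelve (x₁ x₂ x₃ x₄ : ℕ) (r l al : Bool) :
    gift 12 x₁ x₂ x₃ x₄ r l al = 30 + 15 * sides x₁ x₄ r l := by
  simp [gift]

lemma le_gift_of_fifteen_le {d x₁ x₂ x₃ x₄ : ℕ} {r l al : Bool} (h : 15 ≤ d) :
    36 + 18 * sides x₁ x₄ r l ≤ gift d x₁ x₂ x₃ x₄ r l al := by
  unfold gift
  split_ifs <;> omega

lemma not_saturated_of_le {x₁ x₂ x₃ x₄ : ℕ} (h : x₃ ≤ 8) : ¬ Saturated x₁ x₂ x₃ x₄ :=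
  fun hs => absurd hs.2.2.2 (by omega)

lemma giftEleven_of_six_le {y b p q : ℕ} (hy : 6 ≤ y) (hp : p ≤ 6) :
    giftEleven y b p q true = 30 := by
  have h1 : ¬ (y ≤ 5 ∧ b = 10 ∧ p ≤ 8 ∧ q ≤ 8) := by omega
  have h2 : ¬ (q ≤ 5 ∧ p = 10 ∧ b ≤ 8 ∧ y ≤ 8) := by omega
  simp [giftEleven, not_saturated_of_le (show p ≤ 8 by omega), h1, h2]

lemma giftEleven_of_ne {y b p q : ℕ} (hb : b ≠ 10) (hp : p ≤ 6) :
    giftEleven y b p q true = 30 := by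
  have h2 : ¬ (q ≤ 5 ∧ p = 10 ∧ b ≤ 8 ∧ y ≤ 8) := by omega
  simp [giftEleven, not_saturated_of_le (show p ≤ 8 by omega), hb, h2]

lemma le_gift_of_six_le {d y b p q : ℕ} {l : Bool} (h : 9 ≤ d) (hy : 6 ≤ y) (hp : p ≤ 6) :
    30 ≤ gift d y b p q true l true := by
  have hs := one_le_sides (x₄ := q) (l := l) hy
  have h11 := giftEleven_of_six_le (b := b) (q := q) hy hp
  have hZ : ¬ Saturated y b p q := fun h => by unfold Saturated at h; omega
  unfold gift giftThirteen
  rw [if_neg hZ]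
  split_ifs <;> omega

/-- A cyclic sequence `5, 5, A, 5, 10` with `13 ≤ A ≤ 14`, read in this order. -/
def Deficient (a b c d e : ℕ) : Prop :=
  a = 5 ∧ b = 5 ∧ (13 ≤ c ∧ c ≤ 14) ∧ d = 5 ∧ e = 10

def DeficientSeq (n : Fin 5 → ℕ) : Prop :=
  ∃ i, Deficient (n i) (n (i + 1)) (n (i + 2)) (n (i + 3)) (n (i + 4)) ∨
    Deficient (n i) (n (i + 4)) (n (i + 3)) (n (i + 2)) (n (i + 1))

lemma thirty_le_gift {d y b p q : ℕ} {r l : Bool} (h : 11 ≤ d) (hb : b ≠ 10) (hp : p ≤ 6) :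
    30 ≤ gift d y b p q r l true := by
  have h11 := giftEleven_of_ne (y := y) (q := q) hb hp
  have hZ : ¬ Saturated y b p q := not_saturated_of_le (by omega)
  unfold gift giftThirteen
  rw [if_neg hZ]
  split_ifs <;> first | omega | contradiction

lemma thirty_le_gift_of_twelve_le {d y b p q : ℕ} {r l : Bool} (h : 12 ≤ d) (hp : p ≤ 6) :
    30 ≤ gift d y b p q r l true := by
  have hZ : ¬ Saturated y b p q := not_saturated_of_le (by omega)
  unfold gift giftThirteen
  rw [if_neg hZ]
  split_ifs <;> first | omega | contradiction

/-- The gifts of two nonadjacent large vertices `a, b` with cyclic sequence `a, 5, b, p, q`. -/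
lemma sixty_le_gift_add_gift {a b p q : ℕ} (ha : 9 ≤ a) (hab : a ≤ b) (hp : p = 5 ∨ p = 6)
    (hq : q = 5 ∨ q = 6) (l1 : ¬ Light p q a 5 b) (l2 : ¬ Light q p b 5 a) :
    60 ≤ gift a 5 b p q true true true + gift b 5 a q p true true true ∨
    (57 ≤ gift a 5 b p q true true true + gift b 5 a q p true true true ∧
      Deficient q p b 5 a) := by
  have hq' : q ≤ 6 := by omega
  have hp' : p ≤ 6 := by omega
  -- From degree 11 on both gifts are at least 30, as the exceptional gift 24 of an 11-vertex needs
  -- a 10-vertex. For `a` equal to 9 or 10, the forbidden patterns bound `b` from below whenever the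
  -- gift of `a` is small.
  by_cases ha11 : 11 ≤ a
  · have := thirty_le_gift (d := a) (y := 5) (b := b) (p := p) (q := q) (r := true) (l := true)
      ha11 (by omega) hp'
    have := thirty_le_gift (d := b) (y := 5) (b := a) (p := q) (q := p) (r := true) (l := true)
      (by omega) (by omega) hq'
    left; omega
  have h12 : 12 ≤ b → 30 ≤ gift b 5 a q p true true true :=
    fun h => thirty_le_gift_of_twelve_le h hq'
  have h12s : 12 ≤ b → p = 6 → 40 ≤ gift b 5 a q p true true true := fun h hp =>
    le_gift_of_one_le_sides h (not_saturated_of_le (by omega)) (by subst hp; simp [sides])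
  have h13 : 13 ≤ b → 33 ≤ gift b 5 a q p true true true := fun h => by
    simpa using le_gift_of_thirteen_le (d := b) (x₁ := 5) (x₂ := a) (x₃ := q) (x₄ := p)
      (r := true) (l := true) (al := true) h (not_saturated_of_le (by omega))
  have h15 : 15 ≤ b → 36 ≤ gift b 5 a q p true true true := fun h =>
    le_trans (by omega) (le_gift_of_fifteen_le h)
  have h18 : 18 ≤ b → 40 ≤ gift b 5 a q p true true true := fun h =>
    le_trans (by omega) (le_gift_of_eighteen_le h)
  obtain rfl | rfl : a = 9 ∨ a = 10 := by omega
  · rw [gift_nine]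
    left
    have h11 : 11 ≤ b → 30 ≤ gift b 5 9 q p true true true :=
      fun h => thirty_le_gift h (by omega) hq'
    rcases hp with rfl | rfl <;> rcases hq with rfl | rfl <;> norm_num [sides, Light] at l1 l2 ⊢
    · omega
    · omega
    · omega
    · have h9 : b = 9 → 30 ≤ gift b 5 9 6 6 true true true := by
        rintro rfl; simp [gift_nine, sides]
      have h10 : b = 10 → 30 ≤ gift b 5 9 6 6 true true true := by
        rintro rfl; simp [gift_ten, sides]
      omega
  · rw [gift_ten]
    rcases hp with rfl | rfl <;> rcases hq with rfl | rfl <;>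
      norm_num [sides, Light, Deficient] at l1 l2 ⊢
    -- The case 10, 5, b, 5, 5: the pattern 5, 5, 10, 5, 12 gives `b ≥ 13`, and 24 + 33 = 57 is
    -- short of 60 unless `b ≥ 15`, when the gift is 24 + 36. This is the only source of deficiency.
    · omega
    · have h10 : b = 10 → 24 ≤ gift b 5 10 6 5 true true true := by
        rintro rfl; simp [gift_ten]
      have h11 : b = 11 → 24 ≤ gift b 5 10 6 5 true true true := by
        rintro rfl; simp [gift_eleven, giftEleven, Saturated]
      omega
    · have h10 : b = 10 → 36 ≤ gift b 5 10 5 6 true true true := by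
        rintro rfl; simp [gift_ten, sides]
      have h11 : b = 11 → 36 ≤ gift b 5 10 5 6 true true true := by
        rintro rfl; simp [gift_eleven, giftEleven, Saturated]
      omega
    · have h10 : b = 10 → 24 ≤ gift b 5 10 6 6 true true true := by
        rintro rfl; simp [gift_ten]
      have h11 : b = 11 → 24 ≤ gift b 5 10 6 6 true true true := by
        rintro rfl; simp [gift_eleven, giftEleven, Saturated]
      omega

lemma received_of_nonadjacent {n : Fin 5 → ℕ} {t : Fin 5 → Bool} (h : Admissible n)
    (h0 : 9 ≤ n 0) (h1 : n 1 ≤ 8) (h2 : 9 ≤ n 2) (h3 : n 3 ≤ 8) (h4 : n 4 ≤ 8) :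
    60 ≤ received n t ∨ (57 ≤ received n t ∧ allTri t = true ∧ DeficientSeq n) := by
  cases hal : allTri t
  · left
    refine received_of_two_le_of_not_allTri ?_ hal
    unfold numLarge
    rw [large_of_le h0, large_of_le h2]
    omega
  have l1 : ¬ Light (n 3) (n 4) (n 0) (n 1) (n 2) := h.not_light 3
  have l2 : ¬ Light (n 4) (n 3) (n 2) (n 1) (n 0) := h.not_light' 4
  have key := giftAt_add_le_received n t (show (0 : Fin 5) ≠ 2 by decide)
  have ht := allTri_eq_true.1 hal
  rw [giftAt_zero, giftAt_two, hal, ht 0, ht 1, ht 2, ht 4, gift_comm (n 2)] at key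
  replace h1 := h.le_six h1
  replace h3 := h.le_six h3
  replace h4 := h.le_six h4
  have f1 := h.five_le 1
  have f3 := h.five_le 3
  have f4 := h.five_le 4
  obtain h1 | h1 : 6 ≤ n 1 ∨ n 1 = 5 := by omega
  · have := le_gift_of_six_le (b := n 2) (q := n 4) (l := true) h0 h1 h3
    have := le_gift_of_six_le (b := n 0) (q := n 3) (l := true) h2 h1 h4
    left; omega
  · rw [h1] at key l1 l2
    rcases le_total (n 0) (n 2) with hab | hab
    · rcases sixty_le_gift_add_gift h0 hab (p := n 3) (q := n 4) (by omega) (by omega) l1 l2 with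
        hg | ⟨hg, hd⟩
      · left; omega
      · right
        exact ⟨by omega, rfl, 4, Or.inr ⟨hd.1, hd.2.1, hd.2.2.1, h1, hd.2.2.2.2⟩⟩
    · rcases sixty_le_gift_add_gift h2 hab (p := n 4) (q := n 3) (by omega) (by omega) l2 l1 with
        hg | ⟨hg, hd⟩
      · left; omega
      · right
        exact ⟨by omega, rfl, 3, Or.inl ⟨hd.1, hd.2.1, hd.2.2.1, h1, hd.2.2.2.2⟩⟩

lemma numLarge_eq_sum (n : Fin 5 → ℕ) : numLarge n = ∑ i, large (n i) := by
  simp [numLarge, Fin.sum_univ_five]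

lemma numLarge_shift (n : Fin 5 → ℕ) (k : Fin 5) : numLarge (shift k n) = numLarge n := by
  rw [numLarge_eq_sum, numLarge_eq_sum]
  exact Equiv.sum_comp (Equiv.addRight k) (fun i => large (n i))

lemma deficientSeq_of_shift {n : Fin 5 → ℕ} {k : Fin 5} (h : DeficientSeq (shift k n)) :
    DeficientSeq n := by
  obtain ⟨i, hi⟩ := h
  refine ⟨i + k, ?_⟩
  simpa only [shift, add_right_comm] using hi

/-- A vertex of degree five gets enough charge, unless its neighbourhood is deficient. -/
theorem sixty_le_received_or_deficientSeq {n : Fin 5 → ℕ} (h : Admissible n) (t : Fin 5 → Bool) :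
    60 ≤ received n t ∨ (57 ≤ received n t ∧ allTri t = true ∧ DeficientSeq n) := by
  by_cases h3 : 3 ≤ numLarge n
  · exact Or.inl (received_of_three_le h3)
  obtain ⟨i, hi⟩ : ∃ i, 9 ≤ n i := by
    by_contra hc
    push Not at hc
    have hl := h.numLarge_pos
    rw [numLarge_eq_sum, Finset.sum_eq_zero (fun i _ => large_of_lt (by have := hc i; omega))] at hl
    omega
  have back : ∀ k : Fin 5, 60 ≤ received (shift k n) (shift k t) ∨
      (57 ≤ received (shift k n) (shift k t) ∧ allTri (shift k t) = true ∧
        DeficientSeq (shift k n)) →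
      60 ≤ received n t ∨
        (57 ≤ received n t ∧ allTri t = true ∧ DeficientSeq n) := by
    intro k hk
    rw [received_shift, allTri_shift] at hk
    exact hk.imp_right fun ⟨a, b, c⟩ => ⟨a, b, deficientSeq_of_shift c⟩
  apply back i
  have hm := h.shift i
  have hl : numLarge (shift i n) ≤ 2 := by rw [numLarge_shift]; omega
  have h0 : 9 ≤ shift i n 0 := by simpa [shift] using hi
  generalize shift i n = m at *
  generalize shift i t = s at *
  clear back hi h h3
  have hl' := hl
  unfold numLarge at hl'
  rw [large_of_le h0] at hl'
  by_cases h1 : 9 ≤ m 1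
  · exact Or.inl (received_of_adjacent h0 h1)
  by_cases h4 : 9 ≤ m 4
  · left
    rw [← received_shift m s 4]
    exact received_of_adjacent h4 h0
  by_cases h2 : 9 ≤ m 2
  · rw [large_of_le h2] at hl'
    exact received_of_nonadjacent hm h0 (by omega) h2
      (lt_of_large_eq_zero (by omega)) (by omega)
  by_cases h3 : 9 ≤ m 3
  · have hr := received_of_nonadjacent (t := shift 3 s) (hm.shift 3) h3
      (show m 4 ≤ 8 by omega) h0 (show m 1 ≤ 8 by omega) (show m 2 ≤ 8 by omega)
    rw [received_shift, allTri_shift] at hr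
    exact hr.imp_right fun ⟨a, b, c⟩ => ⟨a, b, deficientSeq_of_shift c⟩
  · exact Or.inl (received_of_one hm (by omega) (by omega) (by omega) (by omega))

/-- The surplus of a vertex in a sequence `5, 5, C, p, 10`. -/
lemma le_received_of_ten {n : Fin 5 → ℕ} (h : Admissible n) {t : Fin 5 → Bool}
    (h0 : n 0 = 5) (h1 : n 1 = 5) (h4 : n 4 = 10)
    (hb : ¬ (allTri t = true ∧ 9 ≤ n 2 ∧ n 3 ≤ 5)) : 66 ≤ received n t := by
  have l0 : ¬ Light (n 0) (n 1) (n 2) (n 3) (n 4) := h.not_light 0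
  have s2 := @Admissible.le_six n h 2
  have s3 := @Admissible.le_six n h 3
  -- Otherwise the pattern 5, 6, 6, 6, 17 would occur, with the 10-vertex in the last place.
  have hlarge : 9 ≤ n 2 ∨ 9 ≤ n 3 := by
    unfold Light at l0
    omega
  have n2 : ¬ Saturated (n 3) (n 4) (n 0) (n 1) := not_saturated_of_le (by omega)
  have n3 : ¬ Saturated (n 4) (n 0) (n 1) (n 2) := not_saturated_of_le (by omega)
  have k2 := giftAt_add_le_received n t (show (4 : Fin 5) ≠ 2 by decide)
  have k3 := giftAt_add_le_received n t (show (4 : Fin 5) ≠ 3 by decide)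
  rw [giftAt_four, h4, gift_ten] at k2 k3
  cases hal : allTri t
  · have hs := le_sum_of_not_allTri hal
    rcases hlarge with hl | hl
    · have := le_gift hl n2 (r := t 2) (l := t 1) (al := allTri t)
      rw [giftAt_two] at k2
      omega
    · have := le_gift hl n3 (r := t 3) (l := t 2) (al := allTri t)
      rw [giftAt_three] at k3
      omega
  · have ht := allTri_eq_true.1 hal
    rw [ht 4, ht 3, sides_comm] at k2 k3
    -- With all corners triangular, the neighbour `n 3` of the 10-vertex is thus at least 6 in every
    -- remaining case. The 10-vertex then gives 36, and a second large neighbour adds 30.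
    have hb' : 9 ≤ n 2 → 6 ≤ n 3 := fun h2 => by
      by_contra hc
      exact hb ⟨hal, h2, by omega⟩
    by_cases hl : 9 ≤ n 3
    · have hs := one_le_sides (x₄ := n 0) (l := true) (show 6 ≤ n 3 by omega)
      have := le_gift_of_large_side (x₂ := n 0) (x₃ := n 1) (x₄ := n 2) (l := true) hl
        (show 9 ≤ n 4 by omega)
      rw [giftAt_three, ht 3, ht 2, hal] at k3
      omega
    · have hl2 : 9 ≤ n 2 := by omega
      have hs := one_le_sides (x₄ := n 0) (l := true) (hb' hl2)
      have := le_gift_of_six_le (b := n 4) (p := n 0) (q := n 1) (l := true) hl2 (hb' hl2)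
        (by omega)
      rw [giftAt_two, ht 2, ht 1, hal] at k2
      omega

/-- The surplus of a vertex in a sequence `5, 5, C, p, A` with `C` and `A` at least thirteen. -/
lemma le_received_of_thirteen_le {n : Fin 5 → ℕ} {t : Fin 5 → Bool}
    (h0 : n 0 = 5) (h1 : n 1 = 5) (h2 : 13 ≤ n 2) (h4 : 13 ≤ n 4) :
    66 ≤ received n t := by
  have n2 : ¬ Saturated (n 3) (n 4) (n 0) (n 1) := not_saturated_of_le (by omega)
  have n4 : ¬ Saturated (n 0) (n 1) (n 2) (n 3) := fun h => absurd h.2.2.1 (by omega)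
  have k := giftAt_add_le_received n t (show (4 : Fin 5) ≠ 2 by decide)
  rw [giftAt_four, giftAt_two] at k
  have g2 := le_gift_of_thirteen_le (r := t 2) (l := t 1) (al := allTri t) h2 n2
  have g4 := le_gift_of_thirteen_le (r := t 4) (l := t 3) (al := allTri t) h4 n4
  cases hal : allTri t
  · have hs := le_sum_of_not_allTri hal
    simp only [hal, Bool.false_eq_true, if_false] at *
    omega
  · simp only [hal, if_true] at *
    omega

end MinorStar

/-! ### Mirror images and triangular corners of a rotation system -/

namespace SimpleGraph

namespace RotationSystem

open MinorStar

variable {V : Type*} {G : SimpleGraph V} (R : G.RotationSystem)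

lemma rot_inv_rot (d : G.Dart) : R.rot (R.rot⁻¹ d) = d := Equiv.apply_symm_apply R.rot d

lemma inv_rot_rot (d : G.Dart) : R.rot⁻¹ (R.rot d) = d := Equiv.symm_apply_apply R.rot d

/-- The rotation system of the mirror image. -/
def mirror : G.RotationSystem where
  rot := R.rot⁻¹
  rot_fst d := by
    have := R.rot_fst (R.rot⁻¹ d)
    rw [R.rot_inv_rot] at this
    exact this.symm
  rot_sameCycle d e h := Equiv.Perm.sameCycle_inv.2 (R.rot_sameCycle d e h)

lemma mirror_rot : R.mirror.rot = R.rot⁻¹ := rfl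

lemma mirror_mirror : R.mirror.mirror = R := by
  cases R; simp [mirror]

lemma faceNext_apply (d : G.Dart) : R.faceNext d = R.rot d.symm := rfl

lemma inv_rot_fst (d : G.Dart) : (R.rot⁻¹ d).fst = d.fst := R.mirror.rot_fst d

lemma rot_pow_fst (d : G.Dart) (k : ℕ) : ((R.rot ^ k) d).fst = d.fst := by
  induction k with
  | zero => rfl
  | succ k ih => rw [pow_succ', Equiv.Perm.mul_apply, R.rot_fst, ih]

/-- The face beside the dart `d` is a triangle. -/
def Tri (d : G.Dart) : Prop := R.faceNext (R.faceNext (R.faceNext d)) = d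

lemma tri_faceNext (d : G.Dart) : R.Tri (R.faceNext d) ↔ R.Tri d :=
  R.faceNext.injective.eq_iff

lemma tri_rot_symm (d : G.Dart) : R.Tri (R.rot d.symm) ↔ R.Tri d := R.tri_faceNext d

lemma tri_symm (d : G.Dart) : R.Tri d.symm ↔ R.Tri (R.rot d) := by
  rw [← R.tri_rot_symm, d.symm_symm]

lemma tri_rot_iff (d : G.Dart) :
    R.Tri (R.rot d) ↔ R.rot (R.rot (R.rot d).symm).symm = d.symm := by
  simp only [Tri, faceNext_apply]
  rw [R.rot.injective.eq_iff]
  conv_lhs => rw [← d.symm_symm]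
  rw [Dart.symm_involutive.injective.eq_iff, d.symm_symm]

/-- Reflection reverses the rotation, so the corner assigned to `d` moves from the one before `d` to
the one after it. -/
lemma mirror_tri (d : G.Dart) : R.mirror.Tri d ↔ R.Tri (R.rot d) := by
  rw [tri_rot_iff]
  simp only [Tri, faceNext_apply, mirror_rot]
  rw [Equiv.Perm.inv_eq_iff_eq]
  rw [← Dart.symm_involutive.injective.eq_iff, Dart.symm_symm, Equiv.Perm.inv_eq_iff_eq]
  rw [← Dart.symm_involutive.injective.eq_iff, Dart.symm_symm, Equiv.Perm.inv_eq_iff_eq]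
  exact eq_comm

/-- Across a triangular corner, the next edge at the far end leads to the previous neighbour. -/
lemma snd_rot_symm {d : G.Dart} (h : R.Tri d) : (R.rot d.symm).snd = (R.rot⁻¹ d).snd := by
  obtain ⟨e, rfl⟩ := R.rot.surjective d
  rw [R.inv_rot_rot]
  have h1 := congrArg (fun e : G.Dart => e.fst) ((R.tri_rot_iff e).1 h)
  rw [R.rot_fst] at h1
  exact h1

/-- Both sides are the third edge of the triangle on `d` and `R.rot d`, directed away from the far
end of `d`. -/
lemma inv_rot_symm {d : G.Dart} (h : R.Tri (R.rot d)) :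
    R.rot⁻¹ d.symm = (R.rot (R.rot d).symm).symm := by
  rw [← (R.tri_rot_iff d).1 h, R.inv_rot_rot]

lemma snd_inv_rot_symm {d : G.Dart} (h : R.Tri (R.rot d)) :
    (R.rot⁻¹ d.symm).snd = (R.rot d).snd := by
  rw [R.inv_rot_symm h]
  exact R.rot_fst _

open Classical in
/-- The flags of the corners at `d.fst`: the corner between the `i`-th edge and the next one is
triangular. -/
noncomputable def tris (d : G.Dart) : Fin 5 → Bool :=
  fun i => decide (R.Tri ((R.rot ^ ((i : ℕ) + 1)) d))

lemma tris_zero (d : G.Dart) : R.tris d 0 = true ↔ R.Tri (R.rot d) := by simp [tris]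

lemma tris_one (d : G.Dart) : R.tris d 1 = true ↔ R.Tri (R.rot (R.rot d)) := by
  simp [tris, pow_two]

variable [Fintype V] [DecidableRel G.Adj]

section Cycle

variable [DecidableEq V]

/-- The darts that start at a vertex. -/
abbrev dartsAt (G : SimpleGraph V) [DecidableRel G.Adj] (v : V) : Finset G.Dart :=
  {d : G.Dart | d.fst = v}

lemma isCycleOn_dartsAt (v : V) : R.rot.IsCycleOn (dartsAt G v : Set G.Dart) := by
  refine ⟨⟨fun d hd => ?_, R.rot.injective.injOn, fun d hd => ⟨R.rot⁻¹ d, ?_, R.rot_inv_rot d⟩⟩,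
    fun d hd e he => R.rot_sameCycle d e ?_⟩
  · simpa [R.rot_fst] using hd
  · have := R.inv_rot_fst d
    rw [Finset.coe_filter] at hd ⊢
    exact ⟨Finset.mem_univ _, this.trans hd.2⟩
  · simp at hd he
    rw [hd, he]

lemma rot_pow_eq_iff (d : G.Dart) {m n : ℕ} :
    (R.rot ^ m) d = (R.rot ^ n) d ↔ m ≡ n [MOD G.degree d.fst] := by
  rw [(R.isCycleOn_dartsAt d.fst).pow_apply_eq_pow_apply (by simp),
    G.dart_fst_fiber_card_eq_degree]

lemma rot_pow_degree (d : G.Dart) : (R.rot ^ G.degree d.fst) d = d := by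
  have := (R.isCycleOn_dartsAt d.fst).pow_card_apply (a := d) (by simp)
  rwa [G.dart_fst_fiber_card_eq_degree] at this

lemma sum_dartsAt {M : Type*} [AddCommMonoid M] (d : G.Dart) (F : G.Dart → M) :
    ∑ e ∈ dartsAt G d.fst, F e = ∑ i ∈ Finset.range (G.degree d.fst), F ((R.rot ^ i) d) := by
  symm
  refine Finset.sum_bij (fun i _ => (R.rot ^ i) d) ?_ ?_ ?_ (fun _ _ => rfl)
  · intro i _
    simp [R.rot_pow_fst]
  · intro i hi j hj hij
    rw [R.rot_pow_eq_iff] at hij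
    exact Nat.ModEq.eq_of_lt_of_lt hij (Finset.mem_range.1 hi) (Finset.mem_range.1 hj)
  · intro e he
    obtain ⟨n, hn, rfl⟩ := (R.isCycleOn_dartsAt d.fst).exists_pow_eq (a := d) (by simp) he
    rw [G.dart_fst_fiber_card_eq_degree] at hn
    exact ⟨n, Finset.mem_range.2 hn, rfl⟩

lemma sum_dartsAt_rot {M : Type*} [AddCommMonoid M] (v : V) (F : G.Dart → M) :
    ∑ e ∈ dartsAt G v, F (R.rot e) = ∑ e ∈ dartsAt G v, F e := by
  refine Finset.sum_equiv R.rot ?_ (fun _ _ => rfl)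
  intro e
  simp [R.rot_fst]

end Cycle

/-- The degrees of the neighbours of `d.fst`, starting with `d.snd`. -/
def star (d : G.Dart) : Fin 5 → ℕ := fun i => G.degree ((R.rot ^ (i : ℕ)) d).snd

lemma rot_pow_five {d : G.Dart} (h : G.degree d.fst = 5) : (R.rot ^ 5) d = d := by
  classical
  have := R.rot_pow_degree d
  rwa [h] at this

lemma rot_pow_eq_of_mod {d : G.Dart} (h : G.degree d.fst = 5) {m n : ℕ} (hmn : m % 5 = n % 5) :
    (R.rot ^ m) d = (R.rot ^ n) d := by
  classical
  rw [R.rot_pow_eq_iff, h]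
  exact hmn

lemma rot_pow_rot_pow {d : G.Dart} (h : G.degree d.fst = 5) {k m n : ℕ}
    (hmn : (m + k) % 5 = n % 5) : (R.rot ^ m) ((R.rot ^ k) d) = (R.rot ^ n) d := by
  rw [← Equiv.Perm.mul_apply, ← pow_add]
  exact R.rot_pow_eq_of_mod h hmn

lemma star_rot_pow {d : G.Dart} (h : G.degree d.fst = 5) (k : Fin 5) :
    R.star ((R.rot ^ (k : ℕ)) d) = shift k (R.star d) := by
  funext i
  exact congrArg (fun e : G.Dart => G.degree e.snd)
    (R.rot_pow_rot_pow h (by rw [Fin.val_add, Nat.mod_mod]))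

lemma tris_rot_pow {d : G.Dart} (h : G.degree d.fst = 5) (k : Fin 5) :
    R.tris ((R.rot ^ (k : ℕ)) d) = shift k (R.tris d) := by
  funext i
  exact congrArg (fun e : G.Dart => @decide (R.Tri e) (Classical.propDecidable _))
    (R.rot_pow_rot_pow h (n := ((i + k : Fin 5) : ℕ) + 1) (by rw [Fin.val_add]; omega))

lemma rot_pow_four {d : G.Dart} (h : G.degree d.fst = 5) : (R.rot ^ 4) d = R.rot⁻¹ d := by
  rw [Equiv.Perm.eq_inv_iff_eq, ← Equiv.Perm.mul_apply, ← pow_succ', R.rot_pow_five h]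

lemma rot_pow_three {d : G.Dart} (h : G.degree d.fst = 5) :
    (R.rot ^ 3) d = R.rot⁻¹ (R.rot⁻¹ d) := by
  rw [Equiv.Perm.eq_inv_iff_eq, ← Equiv.Perm.mul_apply, ← pow_succ', R.rot_pow_four h]

lemma star_one (d : G.Dart) : R.star d 1 = G.degree (R.rot d).snd := by
  exact congrArg (fun e : G.Dart => G.degree e.snd) (by simp)

lemma star_two (d : G.Dart) : R.star d 2 = G.degree (R.rot (R.rot d)).snd := by
  exact congrArg (fun e : G.Dart => G.degree e.snd) (by simp [pow_two])

lemma star_three {d : G.Dart} (h : G.degree d.fst = 5) :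
    R.star d 3 = G.degree (R.rot⁻¹ (R.rot⁻¹ d)).snd :=
  congrArg (fun e : G.Dart => G.degree e.snd) (R.rot_pow_three h)

lemma star_four {d : G.Dart} (h : G.degree d.fst = 5) :
    R.star d 4 = G.degree (R.rot⁻¹ d).snd :=
  congrArg (fun e : G.Dart => G.degree e.snd) (R.rot_pow_four h)

lemma tris_three {d : G.Dart} (h : G.degree d.fst = 5) :
    R.tris d 3 = true ↔ R.Tri (R.rot⁻¹ d) := by
  rw [← R.rot_pow_four h]; simp [tris]

lemma tris_four {d : G.Dart} (h : G.degree d.fst = 5) : R.tris d 4 = true ↔ R.Tri d := by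
  have := R.rot_pow_five h
  simp [tris, this]

lemma tris_two {d : G.Dart} (h : G.degree d.fst = 5) :
    R.tris d 2 = true ↔ R.Tri (R.rot⁻¹ (R.rot⁻¹ d)) := by
  rw [← R.rot_pow_three h]; simp [tris]

lemma mirror_star {d : G.Dart} (h : G.degree d.fst = 5) (i : Fin 5) :
    R.mirror.star d i = R.star d (-i) := by
  fin_cases i
  · rfl
  · exact (R.mirror.star_one d).trans (R.star_four h).symm
  · exact (R.mirror.star_two d).trans (R.star_three h).symm
  · refine (R.mirror.star_three h).trans ?_
    rw [mirror_rot, inv_inv]; exact (R.star_two d).symm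
  · refine (R.mirror.star_four h).trans ?_
    rw [mirror_rot, inv_inv]; exact (R.star_one d).symm

/-- A corner lies between the edges `i` and `i + 1`. Reflection sends these to `-i` and `-i - 1`,
and the corner is indexed by the earlier of the two, `-i - 1 = 4 - i`. -/
lemma mirror_tris {d : G.Dart} (h : G.degree d.fst = 5) (i : Fin 5) :
    R.mirror.tris d i = R.tris d (4 - i) := by
  rw [Bool.eq_iff_iff]
  fin_cases i
  · exact (R.mirror.tris_zero d).trans (by
      rw [mirror_tri, mirror_rot, rot_inv_rot]; exact (R.tris_four h).symm)
  · exact (R.mirror.tris_one d).trans (by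
      rw [mirror_tri, mirror_rot, rot_inv_rot]; exact (R.tris_three h).symm)
  · exact (R.mirror.tris_two h).trans (by
      rw [mirror_tri, mirror_rot, inv_inv]
      have := R.tris_two h
      rw [← R.rot_pow_three h] at this
      simpa [pow_succ'] using this.symm)
  · exact (R.mirror.tris_three h).trans (by
      rw [mirror_tri, mirror_rot, inv_inv]; exact (R.tris_one d).symm)
  · exact (R.mirror.tris_four h).trans (by
      rw [mirror_tri]; exact (R.tris_zero d).symm)

lemma mirror_allTri {d : G.Dart} (h : G.degree d.fst = 5) :
    allTri (R.mirror.tris d) = allTri (R.tris d) := by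
  rw [Bool.eq_iff_iff, allTri_eq_true, allTri_eq_true]
  constructor
  · intro H i
    have := H (4 - i)
    rwa [R.mirror_tris h, sub_sub_cancel] at this
  · intro H i
    rw [R.mirror_tris h]; exact H _

/-- What the end vertex of `d` gives to the start vertex of `d`. -/
noncomputable def giftAlong (d : G.Dart) : ℕ :=
  if G.degree d.fst = 5 then giftAt (R.star d) (R.tris d) 0 else 0

lemma giftAlong_mirror (d : G.Dart) : R.mirror.giftAlong d = R.giftAlong d := by
  unfold giftAlong
  split_ifs with h
  · rw [giftAt_zero, giftAt_zero, gift_comm, R.mirror_allTri h]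
    simp only [R.mirror_star h, R.mirror_tris h]
    rfl
  · rfl

lemma giftAlong_rot_pow {d : G.Dart} (h : G.degree d.fst = 5) (k : Fin 5) :
    R.giftAlong ((R.rot ^ (k : ℕ)) d) = giftAt (R.star d) (R.tris d) k := by
  unfold giftAlong
  rw [R.rot_pow_fst, if_pos h, R.star_rot_pow h, R.tris_rot_pow h, giftAt_shift, zero_add]

/-- The hypotheses on degrees, and the absence of the seven stars. -/
structure Avoiding : Prop where
  five_le : ∀ v, 5 ≤ G.degree v
  ne_seven : ∀ v, G.degree v ≠ 7
  ne_eight : ∀ v, G.degree v ≠ 8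
  admissible : ∀ d : G.Dart, G.degree d.fst = 5 → Admissible (R.star d)

lemma Avoiding.mirror {R : G.RotationSystem} (h : R.Avoiding) : R.mirror.Avoiding where
  five_le := h.five_le
  ne_seven := h.ne_seven
  ne_eight := h.ne_eight
  admissible d hd :=
    { five_le := fun _ => h.five_le _
      ne_seven := fun _ => h.ne_seven _
      ne_eight := fun _ => h.ne_eight _
      not_light := fun i => by
        have := (h.admissible d hd).not_light' (-i)
        simp only [R.mirror_star hd, neg_add]
        exact this
      not_light' := fun i => by
        have := (h.admissible d hd).not_light (-i)
        simp only [R.mirror_star hd, neg_add]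
        exact this }

end RotationSystem

end SimpleGraph

/-! ### What a large vertex gives away -/

namespace SimpleGraph

namespace RotationSystem

open MinorStar

variable {V : Type*} {G : SimpleGraph V} (R : G.RotationSystem)

lemma tris_symm_zero (e : G.Dart) : R.tris e.symm 0 = true ↔ R.Tri e := by
  rw [R.tris_zero, R.tri_rot_symm]

variable [Fintype V] [DecidableRel G.Adj]

/-- `0` if the end vertex of `e` has degree five, and `1` otherwise. -/
def nonFive (e : G.Dart) : ℕ := if G.degree e.snd = 5 then 0 else 1

lemma nonFive_eq_zero {e : G.Dart} : nonFive e = 0 ↔ G.degree e.snd = 5 := by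
  unfold nonFive; split_ifs <;> simp_all

lemma nonFive_le_one (e : G.Dart) : nonFive e ≤ 1 := by
  unfold nonFive; split_ifs <;> simp

lemma six_le_le_nonFive (e : G.Dart) : (if 6 ≤ G.degree e.snd then 1 else 0) ≤ nonFive e := by
  unfold nonFive; split_ifs <;> omega

lemma giftAlong_symm {e : G.Dart} (h : G.degree e.snd = 5) :
    R.giftAlong e.symm = gift (G.degree e.fst) (R.star e.symm 1) (R.star e.symm 2)
      (R.star e.symm 3) (R.star e.symm 4) (R.tris e.symm 0) (R.tris e.symm 4)
      (allTri (R.tris e.symm)) := if_pos h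

lemma tris_symm_four {e : G.Dart} (h : G.degree e.snd = 5) :
    R.tris e.symm 4 = true ↔ R.Tri (R.rot e) := by
  rw [R.tris_four h, R.tri_symm]

lemma star_symm_one {e : G.Dart} (h : R.Tri e) :
    R.star e.symm 1 = G.degree (R.rot⁻¹ e).snd := by
  rw [R.star_one, R.snd_rot_symm h]

lemma star_symm_four {e : G.Dart} (h5 : G.degree e.snd = 5) (h : R.Tri (R.rot e)) :
    R.star e.symm 4 = G.degree (R.rot e).snd := by
  rw [R.star_four h5, R.snd_inv_rot_symm h]

/-- The ends of `e` and `R.rot e` are joined by an edge, and the face across that edge is also a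
triangle; its third vertex is the far neighbour seen from both ends. -/
lemma star_symm_two {e : G.Dart} (h5 : G.degree e.snd = 5)
    (h : R.Tri (R.rot e)) (h' : R.Tri (R.rot⁻¹ e.symm)) :
    R.star (R.rot e).symm 2 = R.star e.symm 3 := by
  rw [R.star_two, R.star_three h5, ← R.snd_rot_symm h', R.inv_rot_symm h, Dart.symm_symm]

lemma sides_symm_le {e : G.Dart} (h : G.degree e.snd = 5) :
    sides (R.star e.symm 1) (R.star e.symm 4) (R.tris e.symm 0) (R.tris e.symm 4) ≤
      nonFive (R.rot⁻¹ e) + nonFive (R.rot e) := by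
  unfold sides
  refine add_le_add ?_ ?_
  · split_ifs with h1
    · rw [R.star_symm_one ((R.tris_symm_zero e).1 h1.1)] at h1
      have := six_le_le_nonFive (R.rot⁻¹ e)
      rw [if_pos h1.2] at this
      exact this
    · exact Nat.zero_le _
  · split_ifs with h1
    · rw [R.star_symm_four h ((R.tris_symm_four h).1 h1.1)] at h1
      have := six_le_le_nonFive (R.rot e)
      rw [if_pos h1.2] at this
      exact this
    · exact Nat.zero_le _

variable [DecidableEq V]

/-- The number of neighbours of `v` that do not have degree five. -/
def numNonFive (G : SimpleGraph V) [DecidableRel G.Adj] (v : V) : ℕ :=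
  ∑ e ∈ dartsAt G v, nonFive e

lemma card_dartsAt (v : V) : (dartsAt G v).card = G.degree v :=
  G.dart_fst_fiber_card_eq_degree v

/-- Neighbours not of degree five receive nothing, and each is counted at most twice as a flank of a
receiver. Hence such a neighbour saves `a` and costs at most `2 * b`. -/
lemma sum_giftAlong_add_le (v : V) (a b : ℕ)
    (h : ∀ e ∈ dartsAt G v, G.degree e.snd = 5 →
      R.giftAlong e.symm ≤ a + b * (nonFive (R.rot⁻¹ e) + nonFive (R.rot e))) :
    ∑ e ∈ dartsAt G v, R.giftAlong e.symm + a * numNonFive G v ≤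
      a * G.degree v + 2 * b * numNonFive G v := by
  have h1 : ∑ e ∈ dartsAt G v, (R.giftAlong e.symm + a * nonFive e) ≤
      ∑ e ∈ dartsAt G v, (a + b * (nonFive (R.rot⁻¹ e) + nonFive (R.rot e))) := by
    refine Finset.sum_le_sum fun e he => ?_
    by_cases h5 : G.degree e.snd = 5
    · rw [nonFive_eq_zero.2 h5]
      exact h e he h5
    · have : R.giftAlong e.symm = 0 := if_neg h5
      rw [this]
      have := nonFive_le_one e
      nlinarith
  rw [Finset.sum_add_distrib, Finset.sum_add_distrib, ← Finset.mul_sum, ← Finset.mul_sum,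
    Finset.sum_add_distrib, Finset.sum_const, card_dartsAt, R.sum_dartsAt_rot v nonFive] at h1
  have h2 := R.mirror.sum_dartsAt_rot v nonFive
  rw [R.mirror_rot] at h2
  rw [h2, smul_eq_mul] at h1
  unfold numNonFive
  linarith

lemma sum_le_of_exists_two {α : Type*} [DecidableEq α] {s : Finset α} {f : α → ℕ} {M m : ℕ}
    (hf : ∀ a ∈ s, f a ≤ M) {a b : α} (ha : a ∈ s) (hb : b ∈ s) (hab : a ≠ b) (h1 : f a ≤ m)
    (h2 : f b ≤ m) : ∑ x ∈ s, f x + 2 * M ≤ M * s.card + 2 * m := by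
  have hsub : ({a, b} : Finset α) ⊆ s := by
    intro x hx
    simp only [Finset.mem_insert, Finset.mem_singleton] at hx
    rcases hx with rfl | rfl <;> assumption
  have hc := Finset.card_sdiff_add_card_eq_card hsub
  rw [Finset.card_pair hab] at hc
  have h3 := Finset.sum_sdiff hsub (f := f)
  rw [Finset.sum_pair hab] at h3
  have h4 : ∑ x ∈ s \ {a, b}, f x ≤ M * (s \ {a, b}).card := by
    rw [mul_comm, ← smul_eq_mul]
    exact Finset.sum_le_card_nsmul _ _ _ fun x hx => hf x (Finset.mem_sdiff.1 hx).1
  rw [← hc]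
  nlinarith

lemma sum_le_of_exists_zero {α : Type*} [DecidableEq α] {s : Finset α} {f : α → ℕ} {M : ℕ}
    (hf : ∀ a ∈ s, f a ≤ M) {a : α} (ha : a ∈ s) (h1 : f a = 0) :
    ∑ x ∈ s, f x + M ≤ M * s.card := by
  have h3 := Finset.sum_erase_add s f ha
  have h4 : ∑ x ∈ s.erase a, f x ≤ M * (s.erase a).card := by
    rw [mul_comm, ← smul_eq_mul]
    exact Finset.sum_le_card_nsmul _ _ _ fun x hx => hf x (Finset.mem_of_mem_erase hx)
  have h5 := Finset.card_erase_add_one ha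
  rw [← h5]
  nlinarith

/-- If all neighbours of a vertex of odd degree have degree five, then one of them is
saturated, or two consecutive ones have nontriangular corners. -/
lemma exists_saturated_or_nontriangular {R : G.RotationSystem} (hR : R.Avoiding) {v : V}
    (hodd : Odd (G.degree v)) (h5 : ∀ e ∈ dartsAt G v, G.degree e.snd = 5) :
    (∃ e ∈ dartsAt G v, Saturated (R.star e.symm 1) (R.star e.symm 2) (R.star e.symm 3)
      (R.star e.symm 4)) ∨
    (∃ e ∈ dartsAt G v, allTri (R.tris e.symm) = false ∧
      allTri (R.tris (R.rot e).symm) = false) := by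
  by_contra hc
  push Not at hc
  obtain ⟨hs, hn⟩ := hc
  have mem : ∀ e ∈ dartsAt G v, R.rot e ∈ dartsAt G v := by
    intro e he
    simpa [R.rot_fst] using he
  -- Each of these two triangles has corners at both consecutive neighbours, so a failure of either
  -- would make both neighbours nontriangular.
  have ht : ∀ e ∈ dartsAt G v, R.Tri (R.rot e) ∧ R.Tri (R.rot⁻¹ e.symm) := by
    intro e he
    by_contra hnt
    refine hn e he ?_ ?_
    · rw [← Bool.not_eq_true, allTri_eq_true]
      intro hall
      exact hnt ⟨(R.tris_symm_four (h5 e he)).1 (hall 4), (R.tris_three (h5 e he)).1 (hall 3)⟩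
    · rw [← Bool.not_eq_true, allTri_eq_true]
      intro hall
      have h0 := (R.tris_symm_zero _).1 (hall 0)
      refine hnt ⟨h0, ?_⟩
      have h1 := (R.tris_one _).1 (hall 1)
      rw [← R.tri_rot_symm, R.inv_rot_symm h0, Dart.symm_symm]
      exact h1
  -- Of the two far neighbours of a receiver, the pattern 5, 6, 6, 5 forbids that both are small,
  -- and non-saturation that both are large. One of them is shared with the next receiver, so large
  -- and small alternate.
  have key : ∀ e ∈ dartsAt G v, (9 ≤ R.star (R.rot e).symm 2 ↔ ¬ 9 ≤ R.star e.symm 2) := by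
    intro e he
    have hv := h5 e he
    rw [R.star_symm_two hv (ht e he).1 (ht e he).2]
    have he' : R.rot⁻¹ e ∈ dartsAt G v := by
      have := R.inv_rot_fst e
      simp only [Finset.mem_filter, Finset.mem_univ, true_and] at he ⊢
      rw [this, he]
    have n1 : R.star e.symm 1 = 5 := by
      have := (ht _ he').1
      rw [R.rot_inv_rot] at this
      rw [R.star_symm_one this, h5 _ he']
    have n4 : R.star e.symm 4 = 5 := by
      rw [R.star_symm_four hv (ht e he).1, h5 _ (mem e he)]
    have hadm := hR.admissible e.symm hv
    have hl : ¬ Light (R.star e.symm 1) (R.star e.symm 2) (R.star e.symm 3) (R.star e.symm 4)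
      (R.star e.symm 0) := hadm.not_light 1
    have hs' := hs e he
    constructor
    · intro h3 h2
      exact hs' ⟨n1.le, n4.le, h2, h3⟩
    · intro h2
      by_contra h3
      exact hl (Or.inl ⟨n1.le, hadm.le_six (by omega), hadm.le_six (by omega), n4.le⟩)
  obtain ⟨w, hw⟩ : ∃ w, G.Adj v w := by
    have : 0 < G.degree v := hodd.pos
    rwa [G.degree_pos_iff_exists_adj] at this
  obtain ⟨d, hd⟩ : ∃ d : G.Dart, d.fst = v := ⟨⟨(v, w), hw⟩, rfl⟩
  have alt : ∀ k : ℕ, (9 ≤ R.star ((R.rot ^ k) d).symm 2 ↔ (Even k ↔ 9 ≤ R.star d.symm 2)) := by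
    intro k
    induction k with
    | zero => simp
    | succ k ih =>
      rw [pow_succ', Equiv.Perm.mul_apply, key _ (by simp [R.rot_pow_fst, hd]), ih,
        Nat.even_add_one]
      tauto
  -- After a full turn the dart is the initial one, but the parity has changed.
  have := alt (G.degree v)
  subst hd
  rw [R.rot_pow_degree] at this
  have hne := Nat.not_even_iff_odd.2 hodd
  tauto

end RotationSystem

end SimpleGraph

namespace MinorStar

lemma giftEleven_false_le (x₁ x₂ x₃ x₄ : ℕ) : giftEleven x₁ x₂ x₃ x₄ false ≤ 15 := by
  unfold giftEleven
  split_ifs <;> first | omega | contradiction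

lemma sides_true_true (x₁ x₄ : ℕ) :
    sides x₁ x₄ true true = (if 6 ≤ x₁ then 1 else 0) + (if 6 ≤ x₄ then 1 else 0) := by
  simp [sides]

lemma giftEleven_le (x₁ x₂ x₃ x₄ : ℕ) :
    giftEleven x₁ x₂ x₃ x₄ true ≤ 30 + 6 * sides x₁ x₄ true true := by
  rw [sides_true_true]
  unfold giftEleven
  split_ifs <;> omega

lemma giftEleven_le_thirty_or (x₁ x₂ x₃ x₄ : ℕ) :
    giftEleven x₁ x₂ x₃ x₄ true ≤ 30 ∨
      (x₁ ≤ 5 ∧ x₂ = 10 ∧ 6 ≤ x₄) ∨ (x₄ ≤ 5 ∧ x₃ = 10 ∧ 6 ≤ x₁) := by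
  unfold giftEleven
  split_ifs <;> omega

lemma giftThirteen_le (x₁ x₂ x₃ x₄ : ℕ) (r l al : Bool) :
    giftThirteen x₁ x₂ x₃ x₄ r l al ≤ 33 + 14 * sides x₁ x₄ r l := by
  unfold giftThirteen
  split_ifs <;> omega

lemma giftThirteen_le_of_sides_le {x₁ x₂ x₃ x₄ : ℕ} {r l : Bool} (h : sides x₁ x₄ r l ≤ 1)
    (al : Bool) : giftThirteen x₁ x₂ x₃ x₄ r l al ≤ 33 + 7 * sides x₁ x₄ r l := by
  unfold giftThirteen
  split_ifs <;> omega

lemma giftThirteen_false_le {x₁ x₂ x₃ x₄ : ℕ} {r l : Bool} (h : sides x₁ x₄ r l = 0) :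
    giftThirteen x₁ x₂ x₃ x₄ r l false ≤ 27 := by
  unfold giftThirteen
  rw [if_pos h]
  split_ifs <;> first | omega | contradiction

lemma giftEleven_of_saturated {x₁ x₂ x₃ x₄ : ℕ} (h : Saturated x₁ x₂ x₃ x₄) (al : Bool) :
    giftEleven x₁ x₂ x₃ x₄ al = 0 := if_pos h

lemma giftThirteen_of_saturated {x₁ x₂ x₃ x₄ : ℕ} (h : Saturated x₁ x₂ x₃ x₄) (r l al : Bool) :
    giftThirteen x₁ x₂ x₃ x₄ r l al = 0 := if_pos h

lemma gift_thirteen (x₁ x₂ x₃ x₄ : ℕ) (r l al : Bool) :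
    gift 13 x₁ x₂ x₃ x₄ r l al = giftThirteen x₁ x₂ x₃ x₄ r l al := by
  simp [gift]

lemma gift_fourteen (x₁ x₂ x₃ x₄ : ℕ) (r l al : Bool) :
    gift 14 x₁ x₂ x₃ x₄ r l al = giftThirteen x₁ x₂ x₃ x₄ r l al := by
  simp [gift]

end MinorStar

namespace SimpleGraph

namespace RotationSystem

open MinorStar

variable {V : Type*} {G : SimpleGraph V} (R : G.RotationSystem)

lemma tris_eq_true_of_allTri {e : G.Dart} (h : allTri (R.tris e) = true) (i : Fin 5) :
    R.tris e i = true := allTri_eq_true.1 h i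

variable [Fintype V] [DecidableRel G.Adj]

lemma giftAlong_eleven {e : G.Dart} (h5 : G.degree e.snd = 5) (h : G.degree e.fst = 11) :
    R.giftAlong e.symm = giftEleven (R.star e.symm 1) (R.star e.symm 2)
      (R.star e.symm 3) (R.star e.symm 4) (allTri (R.tris e.symm)) := by
  rw [R.giftAlong_symm h5, h, gift_eleven]

lemma giftAlong_eleven_le {e : G.Dart} (h5 : G.degree e.snd = 5) (h : G.degree e.fst = 11) :
    R.giftAlong e.symm ≤ 30 + 6 * (nonFive (R.rot⁻¹ e) + nonFive (R.rot e)) := by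
  rw [R.giftAlong_eleven h5 h]
  have hs := R.sides_symm_le h5
  cases hal : allTri (R.tris e.symm)
  · exact (giftEleven_false_le ..).trans (by omega)
  · rw [R.tris_eq_true_of_allTri hal, R.tris_eq_true_of_allTri hal] at hs
    exact (giftEleven_le ..).trans (by omega)

/-- A first gift of 36 is caused by a 10-vertex adjacent to both receivers, and the same 10-vertex
lowers the second gift to 24 or saturates it. Nontriangular corners at either receiver leave enough
room as well. -/
lemma giftAlong_eleven_add_le {R : G.RotationSystem} (hR : R.Avoiding) {e : G.Dart}
    (h : G.degree e.fst = 11) (h0 : G.degree e.snd = 5) (h1 : G.degree (R.rot e).snd = 5)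
    (h2 : G.degree (R.rot (R.rot e)).snd = 5) :
    R.giftAlong e.symm + R.giftAlong (R.rot e).symm ≤ 60 := by
  have hf : G.degree (R.rot e).fst = 11 := by rw [R.rot_fst, h]
  have k1 := R.giftAlong_eleven_le h0 h
  have k2 := R.giftAlong_eleven_le h1 hf
  rw [R.inv_rot_rot, nonFive_eq_zero.2 h0, nonFive_eq_zero.2 h2] at k2
  rw [nonFive_eq_zero.2 h1] at k1
  have k3 := nonFive_le_one (R.rot⁻¹ e)
  have e1 := R.giftAlong_eleven h0 h
  cases hal : allTri (R.tris e.symm)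
  · have := giftEleven_false_le (R.star e.symm 1) (R.star e.symm 2) (R.star e.symm 3)
      (R.star e.symm 4)
    rw [hal] at e1
    omega
  rw [hal] at e1
  have ht := R.tris_eq_true_of_allTri hal
  have t4 := (R.tris_symm_four h0).1 (ht 4)
  have t3 := (R.tris_three (d := e.symm) h0).1 (ht 3)
  have n4 : R.star e.symm 4 = 5 := by rw [R.star_symm_four h0 t4, h1]
  rcases giftEleven_le_thirty_or (R.star e.symm 1) (R.star e.symm 2) (R.star e.symm 3)
      (R.star e.symm 4) with hg | hg | hg
  · omega
  · omega
  have m1 : R.star (R.rot e).symm 1 = 5 := by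
    rw [R.star_symm_one t4, R.inv_rot_rot, h0]
  have m2 : R.star (R.rot e).symm 2 = 10 := by
    rw [R.star_symm_two h0 t4 t3, hg.2.1]
  have e2 := R.giftAlong_eleven h1 hf
  cases hal2 : allTri (R.tris (R.rot e).symm)
  · have := giftEleven_false_le (R.star (R.rot e).symm 1) (R.star (R.rot e).symm 2)
      (R.star (R.rot e).symm 3) (R.star (R.rot e).symm 4)
    rw [hal2] at e2
    omega
  have ht2 := R.tris_eq_true_of_allTri hal2
  have m4 : R.star (R.rot e).symm 4 = 5 := by
    rw [R.star_symm_four h1 ((R.tris_symm_four h1).1 (ht2 4)), h2]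
  have hadm := hR.admissible (R.rot e).symm h1
  have hl : ¬ Light (R.star (R.rot e).symm 4) (R.star (R.rot e).symm 3) (R.star (R.rot e).symm 2)
    (R.star (R.rot e).symm 1) (R.star (R.rot e).symm 0) := hadm.not_light' 4
  have m0 : R.star (R.rot e).symm 0 = 11 := hf
  -- A 5 here would complete the pattern 5, 5, 10, 5, 12 with the 11-vertex in the last place.
  have hb : R.star (R.rot e).symm 3 ≤ 8 → 6 ≤ R.star (R.rot e).symm 3 := by
    intro _
    by_contra hc
    refine hl (Or.inr (Or.inr (Or.inr (Or.inr (Or.inr (Or.inl ?_))))))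
    omega
  have : R.giftAlong (R.rot e).symm ≤ 24 := by
    rw [e2, hal2, m1, m2, m4]
    by_cases h9 : 9 ≤ R.star (R.rot e).symm 3
    · rw [giftEleven_of_saturated ⟨le_rfl, le_rfl, by norm_num, h9⟩]
      omega
    · have h6 := hb (by omega)
      have h8 : R.star (R.rot e).symm 3 ≤ 8 := by omega
      simp [giftEleven, not_saturated_of_le h8, h6, h8]
  omega

lemma giftAlong_symm_eq_zero {e : G.Dart} (h : G.degree e.fst ≤ 8) :
    R.giftAlong e.symm = 0 := by
  by_cases h5 : G.degree e.snd = 5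
  · rw [R.giftAlong_symm h5, gift_of_le h]
  · exact if_neg h5

variable [DecidableEq V]

lemma rot_mem_dartsAt {v : V} {e : G.Dart} (he : e ∈ dartsAt G v) : R.rot e ∈ dartsAt G v := by
  have h := R.rot_fst e
  simp only [Finset.mem_filter, Finset.mem_univ, true_and] at he ⊢
  rw [h, he]

lemma inv_rot_mem_dartsAt {v : V} {e : G.Dart} (he : e ∈ dartsAt G v) :
    R.rot⁻¹ e ∈ dartsAt G v := R.mirror.rot_mem_dartsAt he

lemma degree_fst_of_mem {v : V} {e : G.Dart} (he : e ∈ dartsAt G v) :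
    G.degree e.fst = G.degree v := by
  simp only [Finset.mem_filter, Finset.mem_univ, true_and] at he
  rw [he]

lemma degree_snd_of_numNonFive_eq_zero {v : V} (h : numNonFive G v = 0) {e : G.Dart}
    (he : e ∈ dartsAt G v) : G.degree e.snd = 5 :=
  nonFive_eq_zero.1 ((Finset.sum_eq_zero_iff.1 h) e he)

lemma sum_giftAlong_le_of_numNonFive_eq_zero {R : G.RotationSystem} (hR : R.Avoiding) {v : V}
    (hodd : Odd (G.degree v)) (h3 : 3 ≤ G.degree v) (h0 : numNonFive G v = 0) {M m : ℕ}
    (hM : ∀ e ∈ dartsAt G v, R.giftAlong e.symm ≤ M)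
    (hs : ∀ e ∈ dartsAt G v, Saturated (R.star e.symm 1) (R.star e.symm 2) (R.star e.symm 3)
      (R.star e.symm 4) → R.giftAlong e.symm = 0)
    (hm : ∀ e ∈ dartsAt G v, allTri (R.tris e.symm) = false → R.giftAlong e.symm ≤ m) :
    ∑ e ∈ dartsAt G v, R.giftAlong e.symm + M ≤ M * G.degree v ∨
      ∑ e ∈ dartsAt G v, R.giftAlong e.symm + 2 * M ≤ M * G.degree v + 2 * m := by
  rcases exists_saturated_or_nontriangular hR hodd
    (fun e he => degree_snd_of_numNonFive_eq_zero h0 he) with ⟨e, he, h⟩ | ⟨e, he, h1, h2⟩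
  · have := sum_le_of_exists_zero hM he (hs e he h)
    rw [card_dartsAt] at this
    exact Or.inl this
  · have he' := R.rot_mem_dartsAt he
    have hne : e ≠ R.rot e := by
      intro heq
      have := (R.rot_pow_eq_iff e (m := 0) (n := 1)).1 (by simpa using heq)
      rw [degree_fst_of_mem he] at this
      have := (Nat.modEq_iff_dvd' zero_le_one).1 this
      have := Nat.le_of_dvd (by omega) this
      omega
    have := sum_le_of_exists_two hM he he' hne (hm e he h1) (hm _ he' h2)
    rw [card_dartsAt] at this
    exact Or.inr this

/-- The charge 300 pays for ten gifts of 30. With `k` neighbours not of degree five the linear bound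
is `330 - 18 * k`, enough for `k ≥ 2`. For `k = 0` the parity lemma saves 30. For `k = 1` only the
two receivers beside the exceptional vertex can get more than 30, and each is paired with the next
receiver. -/
lemma sum_giftAlong_eleven_le {R : G.RotationSystem} (hR : R.Avoiding) {v : V}
    (hv : G.degree v = 11) : ∑ e ∈ dartsAt G v, R.giftAlong e.symm ≤ 300 := by
  have hfst : ∀ e ∈ dartsAt G v, G.degree e.fst = 11 := fun e he => by
    rw [degree_fst_of_mem he, hv]
  have hsum := R.sum_giftAlong_add_le v 30 6
    (fun e he h5 => R.giftAlong_eleven_le h5 (hfst e he))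
  rw [hv] at hsum
  by_cases hk2 : 2 ≤ numNonFive G v
  · omega
  by_cases hk0 : numNonFive G v = 0
  · have h5 : ∀ e ∈ dartsAt G v, G.degree e.snd = 5 := fun e he =>
      degree_snd_of_numNonFive_eq_zero hk0 he
    have := sum_giftAlong_le_of_numNonFive_eq_zero hR (by rw [hv]; decide) (by omega) hk0
      (M := 30) (m := 15) (fun e he => by
        have := R.giftAlong_eleven_le (h5 e he) (hfst e he)
        rwa [nonFive_eq_zero.2 (h5 _ (R.rot_mem_dartsAt he)),
          nonFive_eq_zero.2 (h5 _ (R.inv_rot_mem_dartsAt he))] at this)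
      (fun e he hs => by
        rw [R.giftAlong_eleven (h5 e he) (hfst e he), giftEleven_of_saturated hs])
      (fun e he h1 => by
        rw [R.giftAlong_eleven (h5 e he) (hfst e he), h1]; exact giftEleven_false_le ..)
    rw [hv] at this
    omega
  · have hk1 : numNonFive G v = 1 := by omega
    obtain ⟨z, hz, hz1⟩ : ∃ z ∈ dartsAt G v, nonFive z ≠ 0 := by
      by_contra hc
      push Not at hc
      exact hk0 (Finset.sum_eq_zero hc)
    have hzv : z.fst = v := by simpa using hz
    subst hzv
    have hz' : nonFive z = 1 := by have := nonFive_le_one z; omega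
    rw [numNonFive, R.sum_dartsAt z nonFive, hv] at hk1
    rw [R.sum_dartsAt z (fun e => R.giftAlong e.symm), hv]
    simp only [Finset.sum_range_succ, Finset.sum_range_zero, pow_zero, Equiv.Perm.one_apply,
      zero_add, hz'] at hk1 ⊢
    have f : ∀ k, 1 ≤ k → k ≤ 10 → G.degree ((R.rot ^ k) z).snd = 5 := by
      intro k _ _
      rw [← nonFive_eq_zero]
      interval_cases k <;> omega
    have hd : ∀ k, G.degree ((R.rot ^ k) z).fst = 11 := fun k => by rw [R.rot_pow_fst, hv]
    have s : ∀ k, R.rot ((R.rot ^ k) z) = (R.rot ^ (k + 1)) z := fun k => by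
      rw [pow_succ', Equiv.Perm.mul_apply]
    have s' : ∀ k, R.rot⁻¹ ((R.rot ^ (k + 1)) z) = (R.rot ^ k) z := fun k => by
      rw [← s, R.inv_rot_rot]
    have g0 : R.giftAlong z.symm = 0 := if_neg (fun h => hz1 (nonFive_eq_zero.2 h))
    have g : ∀ k, 1 ≤ k → k ≤ 8 → R.giftAlong ((R.rot ^ (k + 1)) z).symm ≤ 30 := by
      intro k h1 h2
      have := R.giftAlong_eleven_le (f (k + 1) (by omega) (by omega)) (hd (k + 1))
      rwa [s, s', nonFive_eq_zero.2 (f k (by omega) (by omega)),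
        nonFive_eq_zero.2 (f (k + 1 + 1) (by omega) (by omega))] at this
    have p1 : R.giftAlong ((R.rot ^ 1) z).symm + R.giftAlong ((R.rot ^ 2) z).symm ≤ 60 := by
      have := giftAlong_eleven_add_le hR (hd 1) (f 1 (by omega) (by omega))
        (by rw [s]; exact f 2 (by omega) (by omega))
        (by rw [s, s]; exact f 3 (by omega) (by omega))
      rwa [s] at this
    -- The same pairing on the other side of `z`, read in the mirror image.
    have p2 : R.giftAlong ((R.rot ^ 10) z).symm + R.giftAlong ((R.rot ^ 9) z).symm ≤ 60 := by
      have := giftAlong_eleven_add_le hR.mirror (hd 10) (f 10 (by omega) (by omega))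
        (by rw [mirror_rot, s' 9]; exact f 9 (by omega) (by omega))
        (by rw [mirror_rot, s' 9, s' 8]; exact f 8 (by omega) (by omega))
      rwa [mirror_rot, s' 9, giftAlong_mirror, giftAlong_mirror] at this
    have : R.giftAlong ((R.rot ^ 3) z).symm ≤ 30 := g 2 (by omega) (by omega)
    have : R.giftAlong ((R.rot ^ 4) z).symm ≤ 30 := g 3 (by omega) (by omega)
    have : R.giftAlong ((R.rot ^ 5) z).symm ≤ 30 := g 4 (by omega) (by omega)
    have : R.giftAlong ((R.rot ^ 6) z).symm ≤ 30 := g 5 (by omega) (by omega)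
    have : R.giftAlong ((R.rot ^ 7) z).symm ≤ 30 := g 6 (by omega) (by omega)
    have : R.giftAlong ((R.rot ^ 8) z).symm ≤ 30 := g 7 (by omega) (by omega)
    omega

lemma numNonFive_ge_two {v : V} {e e' : G.Dart} (he : e ∈ dartsAt G v) (he' : e' ∈ dartsAt G v)
    (hne : e ≠ e') (h : nonFive e = 1) (h' : nonFive e' = 1) : 2 ≤ numNonFive G v := by
  have hsub : ({e, e'} : Finset G.Dart) ⊆ dartsAt G v := by
    intro x hx
    simp only [Finset.mem_insert, Finset.mem_singleton] at hx
    rcases hx with rfl | rfl <;> assumption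
  have := Finset.sum_le_sum_of_subset (f := nonFive) hsub
  rw [Finset.sum_pair hne, h, h'] at this
  exact this

/-- With `k` exceptional neighbours the crude slope 14 gives `429 - 5 * k`, enough for `k ≥ 2`. For
`k = 1` no receiver is flanked twice, so slope 7 is available and gives 410. For `k = 0` the parity
lemma saves 33 or 12 out of 429. -/
lemma sum_giftAlong_thirteen_le {R : G.RotationSystem} (hR : R.Avoiding) {v : V}
    (hv : G.degree v = 13) : ∑ e ∈ dartsAt G v, R.giftAlong e.symm ≤ 420 := by
  have hfst : ∀ e ∈ dartsAt G v, G.degree e.fst = 13 := fun e he => by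
    rw [degree_fst_of_mem he, hv]
  by_cases hk2 : 2 ≤ numNonFive G v
  · have hsum := R.sum_giftAlong_add_le v 33 14 (fun e he h5 => by
      rw [R.giftAlong_symm h5, hfst e he, gift_thirteen]
      refine (giftThirteen_le ..).trans ?_
      have := R.sides_symm_le h5
      omega)
    rw [hv] at hsum
    omega
  have hle : ∀ e ∈ dartsAt G v, nonFive (R.rot⁻¹ e) + nonFive (R.rot e) ≤ 1 := by
    intro e he
    by_contra hc
    have h1 := nonFive_le_one (R.rot⁻¹ e)
    have h2 := nonFive_le_one (R.rot e)
    refine hk2 (numNonFive_ge_two (R.inv_rot_mem_dartsAt he) (R.rot_mem_dartsAt he) ?_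
      (by omega) (by omega))
    intro heq
    rw [Equiv.Perm.inv_eq_iff_eq] at heq
    have := (R.rot_pow_eq_iff e (m := 0) (n := 2)).1 (by simpa [pow_two] using heq)
    rw [hfst e he] at this
    revert this; decide
  have hbound : ∀ e ∈ dartsAt G v, G.degree e.snd = 5 →
      R.giftAlong e.symm ≤ 33 + 7 * (nonFive (R.rot⁻¹ e) + nonFive (R.rot e)) := fun e he h5 => by
    rw [R.giftAlong_symm h5, hfst e he, gift_thirteen]
    have := R.sides_symm_le h5
    have := hle e he
    refine (giftThirteen_le_of_sides_le (by omega) _).trans ?_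
    omega
  by_cases hk0 : numNonFive G v = 0
  · have h5 : ∀ e ∈ dartsAt G v, G.degree e.snd = 5 := fun e he =>
      degree_snd_of_numNonFive_eq_zero hk0 he
    have hz : ∀ e ∈ dartsAt G v, nonFive (R.rot⁻¹ e) + nonFive (R.rot e) = 0 := fun e he => by
      rw [nonFive_eq_zero.2 (h5 _ (R.rot_mem_dartsAt he)),
        nonFive_eq_zero.2 (h5 _ (R.inv_rot_mem_dartsAt he))]
    have := sum_giftAlong_le_of_numNonFive_eq_zero hR (by rw [hv]; decide) (by omega) hk0
      (M := 33) (m := 27) (fun e he => by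
        have := hbound e he (h5 e he)
        rwa [hz e he] at this)
      (fun e he hs => by
        rw [R.giftAlong_symm (h5 e he), hfst e he, gift_thirteen, giftThirteen_of_saturated hs])
      (fun e he h1 => by
        rw [R.giftAlong_symm (h5 e he), hfst e he, gift_thirteen, h1]
        have := R.sides_symm_le (h5 e he)
        rw [hz e he] at this
        exact giftThirteen_false_le (by omega))
    rw [hv] at this
    omega
  · have hsum := R.sum_giftAlong_add_le v 33 7 hbound
    rw [hv] at hsum
    omega

/-- No vertex gives more than its initial charge. -/
theorem sum_giftAlong_le {R : G.RotationSystem} (hR : R.Avoiding) {v : V}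
    (hv : G.degree v ≠ 5) :
    ∑ e ∈ dartsAt G v, R.giftAlong e.symm + 360 ≤ 60 * G.degree v := by
  have h5 := hR.five_le v
  have h7 := hR.ne_seven v
  have h8 := hR.ne_eight v
  have hfst : ∀ e ∈ dartsAt G v, G.degree e.fst = G.degree v := fun e he => degree_fst_of_mem he
  -- The equal-share rule: if the two half shares cost at most one full share, exceptional
  -- neighbours never increase the total beyond `a` per neighbour.
  have linear : ∀ a b : ℕ, 2 * b ≤ a →
      (∀ x₁ x₂ x₃ x₄ r l al, gift (G.degree v) x₁ x₂ x₃ x₄ r l al ≤ a + b * sides x₁ x₄ r l) →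
      ∑ e ∈ dartsAt G v, R.giftAlong e.symm ≤ a * G.degree v := by
    intro a b hab hg
    have hsum := R.sum_giftAlong_add_le v a b (fun e he h5 => by
      rw [R.giftAlong_symm h5, hfst e he]
      refine (hg ..).trans ?_
      have := R.sides_symm_le h5
      gcongr)
    have : 2 * b * numNonFive G v ≤ a * numNonFive G v := by gcongr
    omega
  have hc : G.degree v = 6 ∨ G.degree v = 9 ∨ G.degree v = 10 ∨ G.degree v = 11 ∨
      G.degree v = 12 ∨ G.degree v = 13 ∨ G.degree v = 14 ∨ 15 ≤ G.degree v ∧ G.degree v ≤ 17 ∨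
      18 ≤ G.degree v := by omega
  rcases hc with h | h | h | h | h | h | h | h | h
  · have := linear 0 0 (by omega) (fun _ _ _ _ _ _ _ => by rw [gift_of_le (by omega)]; simp)
    omega
  · have := linear 20 10 (by omega) (fun _ _ _ _ _ _ _ => by rw [h, gift_nine])
    omega
  · have := linear 24 12 (by omega) (fun _ _ _ _ _ _ _ => by rw [h, gift_ten])
    omega
  · have := sum_giftAlong_eleven_le hR h
    omega
  · have := linear 30 15 (by omega) (fun _ _ _ _ _ _ _ => by rw [h, gift_twelve])
    omega
  · have := sum_giftAlong_thirteen_le hR h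
    omega
  · have := linear 33 14 (by omega) (fun _ _ _ _ _ _ _ => by
      rw [h, gift_fourteen]; exact giftThirteen_le ..)
    omega
  · have := linear 36 18 (by omega) (fun _ _ _ _ _ _ _ => by
      unfold gift; split_ifs <;> omega)
    omega
  · have := linear 40 20 (by omega) (fun _ _ _ _ _ _ _ => by
      unfold gift; split_ifs <;> omega)
    omega

end RotationSystem

end SimpleGraph

/-! ### Loans between vertices of degree five -/

namespace MinorStar

/-- The `i`-th neighbour has degree five, and so has exactly one of the two next to it, the other
one being large. -/
def RunEnd (n : Fin 5 → ℕ) (i : Fin 5) : Prop :=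
  n i = 5 ∧ ((n (i + 1) = 5 ∧ 9 ≤ n (i + 4)) ∨ (n (i + 4) = 5 ∧ 9 ≤ n (i + 1)))

instance (n : Fin 5 → ℕ) (i : Fin 5) : Decidable (RunEnd n i) := by
  unfold RunEnd; infer_instance

/-- `0` for degree five, `1` for a large degree and `2` otherwise. -/
def degreeClass (k : ℕ) : Fin 3 := if k = 5 then 0 else if 9 ≤ k then 1 else 2

lemma degreeClass_eq_zero {k : ℕ} : k = 5 ↔ degreeClass k = 0 := by
  unfold degreeClass; split_ifs <;> simp_all

lemma degreeClass_eq_one {k : ℕ} : 9 ≤ k ↔ degreeClass k = 1 := by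
  unfold degreeClass; split_ifs <;> simp_all

/-- Each such position ends a maximal run of at least two fives. Two runs of this kind would need
two separators, six places in all, so there is at most one run and it has two ends. -/
lemma sum_runEnd_le (n : Fin 5 → ℕ) : ∑ i, (if RunEnd n i then 3 else 0) ≤ 6 := by
  have key : ∀ a b c d e : Fin 3,
      (if a = 0 ∧ ((b = 0 ∧ e = 1) ∨ (e = 0 ∧ b = 1)) then 3 else 0) +
      (if b = 0 ∧ ((c = 0 ∧ a = 1) ∨ (a = 0 ∧ c = 1)) then 3 else 0) +
      (if c = 0 ∧ ((d = 0 ∧ b = 1) ∨ (b = 0 ∧ d = 1)) then 3 else 0) +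
      (if d = 0 ∧ ((e = 0 ∧ c = 1) ∨ (c = 0 ∧ e = 1)) then 3 else 0) +
      (if e = 0 ∧ ((a = 0 ∧ d = 1) ∨ (d = 0 ∧ a = 1)) then 3 else 0) ≤ 6 := by
    decide
  have h := key (degreeClass (n 0)) (degreeClass (n 1)) (degreeClass (n 2)) (degreeClass (n 3))
    (degreeClass (n 4))
  simp only [← degreeClass_eq_zero, ← degreeClass_eq_one] at h
  rw [Fin.sum_univ_five]
  exact h

end MinorStar

namespace SimpleGraph

namespace RotationSystem

open MinorStar

variable {V : Type*} {G : SimpleGraph V} (R : G.RotationSystem)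

open Classical in
/-- The charge that `d.fst` gets from the face beside `d`. -/
noncomputable def faceGift (d : G.Dart) : ℕ := if R.Tri d then 0 else 30

lemma faceGift_mirror (d : G.Dart) : R.mirror.faceGift d = R.faceGift (R.rot d) := by
  by_cases h : R.Tri (R.rot d) <;> simp [faceGift, R.mirror_tri, h]

variable [Fintype V] [DecidableRel G.Adj]

/-- The star at `d.fst`, read from `d`, is `5, 5, A, 5, 10` with `13 ≤ A ≤ 14`, and all its
corners are triangular. -/
def DeficientAt (d : G.Dart) : Prop :=
  G.degree d.fst = 5 ∧ allTri (R.tris d) = true ∧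
    Deficient (R.star d 0) (R.star d 1) (R.star d 2) (R.star d 3) (R.star d 4)

/-- Given a deficient star read from `e.symm`, the star at `e.fst` is triangular with only two
large vertices. -/
def Unable (e : G.Dart) : Prop :=
  allTri (R.mirror.tris e) = true ∧ 9 ≤ R.mirror.star e 2 ∧ R.mirror.star e 3 ≤ 5

/-- The deficient vertex `d.fst` asks `d.snd` for charge, for one of the two orientations. -/
def AsksOriented (d : G.Dart) : Prop :=
  (R.DeficientAt d ∧ ¬ R.Unable d.symm) ∨
    (R.DeficientAt (R.rot⁻¹ d) ∧ R.Unable (R.rot⁻¹ d).symm)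

/-- The deficient vertex `d.fst` asks `d.snd` for charge. -/
def Asks (d : G.Dart) : Prop := R.AsksOriented d ∨ R.mirror.AsksOriented d

lemma exists_asksOriented {d : G.Dart} (h : R.DeficientAt d) :
    R.AsksOriented d ∨ R.AsksOriented (R.rot d) := by
  by_cases hu : R.Unable d.symm
  · right; right
    rw [R.inv_rot_rot]
    exact ⟨h, hu⟩
  · exact Or.inl (Or.inl ⟨h, hu⟩)

lemma exists_asks {d : G.Dart} (h5 : G.degree d.fst = 5) (ht : allTri (R.tris d) = true)
    (hd : DeficientSeq (R.star d)) : ∃ e : G.Dart, e.fst = d.fst ∧ R.Asks e := by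
  obtain ⟨i, hi⟩ := hd
  have h5' : G.degree ((R.rot ^ (i : ℕ)) d).fst = 5 := by rw [R.rot_pow_fst, h5]
  have ht' : allTri (R.tris ((R.rot ^ (i : ℕ)) d)) = true := by
    rw [R.tris_rot_pow h5, allTri_shift, ht]
  rcases hi with hi | hi
  · have hdef : R.DeficientAt ((R.rot ^ (i : ℕ)) d) := by
      refine ⟨h5', ht', ?_⟩
      rw [R.star_rot_pow h5]
      simpa only [shift, add_comm, zero_add, add_zero] using hi
    rcases R.exists_asksOriented hdef with ha | ha
    · exact ⟨_, R.rot_pow_fst _ _, Or.inl ha⟩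
    · exact ⟨_, (R.rot_fst _).trans (R.rot_pow_fst _ _), Or.inl ha⟩
  · have hdef : R.mirror.DeficientAt ((R.rot ^ (i : ℕ)) d) := by
      refine ⟨h5', by rw [R.mirror_allTri h5', ht'], ?_⟩
      simp only [R.mirror_star h5']
      rw [R.star_rot_pow h5]
      simp only [shift, add_comm _ i]
      simpa [show (-1 : Fin 5) = 4 from rfl, show (-2 : Fin 5) = 3 from rfl,
        show (-3 : Fin 5) = 2 from rfl, show (-4 : Fin 5) = 1 from rfl] using hi
    rcases R.mirror.exists_asksOriented hdef with ha | ha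
    · exact ⟨_, R.rot_pow_fst _ _, Or.inr ha⟩
    · exact ⟨_, (R.inv_rot_fst _).trans (R.rot_pow_fst _ _), Or.inr ha⟩

/-- The neighbours next to `d.fst` around `d.snd` are the neighbours next to `d.snd` around
`d.fst`. -/
lemma star_symm_of_deficientAt {d : G.Dart} (h : R.DeficientAt d) :
    G.degree d.snd = 5 ∧ R.star d.symm 1 = 10 ∧ R.star d.symm 4 = 5 := by
  obtain ⟨h5, ht, h0, h1, h2, h3, h4⟩ := h
  have t := R.tris_eq_true_of_allTri ht
  have hs : G.degree d.snd = 5 := h0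
  refine ⟨hs, ?_, ?_⟩
  · rw [R.star_symm_one ((R.tris_four h5).1 (t 4)), ← R.star_four h5, h4]
  · rw [R.star_symm_four hs ((R.tris_zero d).1 (t 0)), ← R.star_one, h1]

lemma star_symm_rot_of_deficientAt {d : G.Dart} (h : R.DeficientAt d) :
    G.degree (R.rot d).snd = 5 ∧ R.star (R.rot d).symm 1 = 5 ∧
      13 ≤ R.star (R.rot d).symm 4 := by
  obtain ⟨h5, ht, h0, h1, h2, h3, h4⟩ := h
  have t := R.tris_eq_true_of_allTri ht
  have hs : G.degree (R.rot d).snd = 5 := by rw [← R.star_one, h1]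
  refine ⟨hs, ?_, ?_⟩
  · rw [R.star_symm_one ((R.tris_zero d).1 (t 0)), R.inv_rot_rot]
    exact h0
  · rw [R.star_symm_four hs ((R.tris_one d).1 (t 1)), ← R.star_two]
    exact h2.1

/-- An asked vertex has degree five, and the asking vertex ends a run of vertices of degree five
around it. -/
lemma runEnd_of_asksOriented {d : G.Dart} (h : R.AsksOriented d) :
    G.degree d.snd = 5 ∧ RunEnd (R.star d.symm) 0 := by
  rcases h with ⟨h, -⟩ | ⟨h, -⟩
  · obtain ⟨h5, h1, h4⟩ := R.star_symm_of_deficientAt h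
    exact ⟨h5, h.1, Or.inr ⟨h4, by change 9 ≤ R.star d.symm 1; omega⟩⟩
  · have h0 := h.1
    rw [R.inv_rot_fst] at h0
    obtain ⟨h5, h1, h4⟩ := R.star_symm_rot_of_deficientAt h
    rw [R.rot_inv_rot] at h5 h1 h4
    exact ⟨h5, h0, Or.inl ⟨h1, by change 9 ≤ R.star d.symm 4; omega⟩⟩

lemma runEnd_of_asks {d : G.Dart} (h : R.Asks d) :
    G.degree d.snd = 5 ∧ RunEnd (R.star d.symm) 0 := by
  rcases h with h | h
  · exact R.runEnd_of_asksOriented h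
  · obtain ⟨h5, h0, h⟩ := R.mirror.runEnd_of_asksOriented h
    have h5' : G.degree d.symm.fst = 5 := h5
    refine ⟨h5, h0, ?_⟩
    simp only [R.mirror_star h5'] at h
    exact h.symm

/-- The first choice of lender sees 5, 5, C, p, 10 in the mirror image, which yields 66 unless it is
itself of the shape 5, 5, C, 5, 10 with all corners triangular. In that case `C ≥ 13` by the pattern
5, 5, 10, 5, 12, and the second choice sees 5, 5, C, p, A with the same `C`, so that two gifts of at
least 33 reach it, or two of at least 27 together with a face gift. -/
lemma le_received_of_asksOriented {R : G.RotationSystem} (hR : R.Avoiding) {d : G.Dart}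
    (h : R.AsksOriented d) :
    66 ≤ received (R.star d.symm) (R.tris d.symm) ∨
      66 ≤ received (R.mirror.star d.symm) (R.mirror.tris d.symm) := by
  rcases h with ⟨h, hu⟩ | ⟨h, hu⟩
  · right
    obtain ⟨h5, h1, h4⟩ := R.star_symm_of_deficientAt h
    have h5' : G.degree d.symm.fst = 5 := h5
    refine le_received_of_ten (hR.mirror.admissible _ h5') h.1 ?_ ?_ hu
    · rw [R.mirror_star h5']; exact h4
    · rw [R.mirror_star h5']; exact h1
  · left
    obtain ⟨h5, h1, h4⟩ := R.star_symm_rot_of_deficientAt h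
    obtain ⟨p5, p1, p4⟩ := R.star_symm_of_deficientAt h
    obtain ⟨e, rfl⟩ := R.rot.surjective d
    rw [R.rot_inv_rot] at h1 h4
    rw [R.inv_rot_rot] at h hu p5 p1 p4
    have p5' : G.degree e.symm.fst = 5 := p5
    obtain ⟨ht, h9, h3⟩ := hu
    have hadm := hR.mirror.admissible e.symm p5'
    have hl : ¬ Light (R.mirror.star e.symm 1) (R.mirror.star e.symm 0) (R.mirror.star e.symm 4)
      (R.mirror.star e.symm 3) (R.mirror.star e.symm 2) := hadm.not_light' 1
    have m0 : R.mirror.star e.symm 0 = 5 := h.1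
    have m1 : R.mirror.star e.symm 1 = 5 := by rw [R.mirror_star p5']; exact p4
    have m4 : R.mirror.star e.symm 4 = 10 := by rw [R.mirror_star p5']; exact p1
    have h13 : 13 ≤ R.mirror.star e.symm 2 := by
      by_contra hc
      refine hl (Or.inr (Or.inr (Or.inr (Or.inr (Or.inr (Or.inl ?_))))))
      omega
    rw [R.mirror_allTri p5'] at ht
    have t := R.tris_eq_true_of_allTri ht
    have t0 := R.tris_eq_true_of_allTri h.2.1 0
    refine le_received_of_thirteen_le ?_ h1 ?_ h4
    · exact (congrArg (fun v => G.degree v) (R.rot_fst e)).trans h.1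
    -- The two candidate lenders share the large vertex `C` across the edge joining them.
    · rw [R.star_symm_two p5 ((R.tris_zero e).1 t0) ((R.tris_three p5').1 (t 3))]
      rw [R.mirror_star p5'] at h13
      exact h13

lemma sum_symm {M : Type*} [AddCommMonoid M] (F : G.Dart → M) :
    ∑ e : G.Dart, F e.symm = ∑ e, F e :=
  Equiv.sum_comp (Function.Involutive.toPerm _ (Dart.symm_involutive (G := G))) F

section Sums

variable [DecidableEq V]

lemma sum_dartsAt_of_five {M : Type*} [AddCommMonoid M] {d : G.Dart} (h : G.degree d.fst = 5)
    (F : G.Dart → M) :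
    ∑ e ∈ dartsAt G d.fst, F e = ∑ i : Fin 5, F ((R.rot ^ (i : ℕ)) d) := by
  rw [R.sum_dartsAt, h, Finset.sum_range]

open Classical in
/-- The charge that `d.fst` gets from `d.snd` on request. -/
noncomputable def loan (d : G.Dart) : ℕ := if R.Asks d then 3 else 0

lemma received_eq_sum {d : G.Dart} (h : G.degree d.fst = 5) :
    received (R.star d) (R.tris d) =
      ∑ e ∈ dartsAt G d.fst, R.giftAlong e + ∑ e ∈ dartsAt G d.fst, R.faceGift e := by
  rw [← R.sum_dartsAt_rot d.fst R.faceGift, R.sum_dartsAt_of_five h, R.sum_dartsAt_of_five h]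
  unfold received
  congr 1
  · exact Finset.sum_congr rfl fun i _ => (R.giftAlong_rot_pow h i).symm
  · refine Finset.sum_congr rfl fun i _ => ?_
    rw [← Equiv.Perm.mul_apply, ← pow_succ']
    by_cases ht : R.Tri ((R.rot ^ ((i : ℕ) + 1)) d) <;> simp [faceGift, tris, ht]

lemma received_mirror {d : G.Dart} (h : G.degree d.fst = 5) :
    received (R.mirror.star d) (R.mirror.tris d) = received (R.star d) (R.tris d) := by
  rw [R.received_eq_sum h, R.mirror.received_eq_sum h, ← R.sum_dartsAt_rot d.fst R.faceGift]
  simp only [R.giftAlong_mirror, R.faceGift_mirror]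

lemma le_received_of_asks {R : G.RotationSystem} (hR : R.Avoiding) {d : G.Dart}
    (h : R.Asks d) : 66 ≤ received (R.star d.symm) (R.tris d.symm) := by
  have h5 : G.degree d.symm.fst = 5 := (R.runEnd_of_asks h).1
  rcases h with h | h
  · have := le_received_of_asksOriented hR h
    rwa [R.received_mirror h5, or_self] at this
  · have := le_received_of_asksOriented hR.mirror h
    rwa [R.mirror.received_mirror h5, R.received_mirror h5, or_self] at this

lemma sum_loan_symm_le {d : G.Dart} (h : G.degree d.fst = 5) :
    ∑ e ∈ dartsAt G d.fst, R.loan e.symm ≤ 6 := by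
  rw [R.sum_dartsAt_of_five h]
  refine le_trans (Finset.sum_le_sum fun i _ => ?_) (sum_runEnd_le (R.star d))
  unfold loan
  split_ifs with h1 h2 h2
  · exact le_rfl
  · obtain ⟨-, hr⟩ := R.runEnd_of_asks h1
    rw [Dart.symm_symm, R.star_rot_pow h] at hr
    refine absurd ?_ h2
    unfold RunEnd at hr ⊢
    simpa only [shift, zero_add, add_zero, add_comm] using hr
  · exact Nat.zero_le _
  · exact le_rfl

/-- The balance of charge at a vertex. -/
theorem vertex_balance {R : G.RotationSystem} (hR : R.Avoiding) (v : V) :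
    ∑ e ∈ dartsAt G v, R.giftAlong e.symm + ∑ e ∈ dartsAt G v, R.loan e.symm + 360 ≤
      60 * G.degree v + ∑ e ∈ dartsAt G v, R.giftAlong e + ∑ e ∈ dartsAt G v, R.faceGift e +
        ∑ e ∈ dartsAt G v, R.loan e := by
  by_cases h5 : G.degree v = 5
  · obtain ⟨w, hw⟩ : ∃ w, G.Adj v w := by
      have : 0 < G.degree v := by omega
      rwa [G.degree_pos_iff_exists_adj] at this
    obtain ⟨d, rfl⟩ : ∃ d : G.Dart, d.fst = v := ⟨⟨(v, w), hw⟩, rfl⟩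
    have hz : ∑ e ∈ dartsAt G d.fst, R.giftAlong e.symm = 0 :=
      Finset.sum_eq_zero fun e he => R.giftAlong_symm_eq_zero (by
        rw [degree_fst_of_mem he]; omega)
    have hrec := R.received_eq_sum h5
    have hcases := sixty_le_received_or_deficientSeq (hR.admissible d h5) (R.tris d)
    -- An asked vertex keeps 60 after lending at most 6, whether or not it is deficient itself. A
    -- vertex that is not asked lends nothing and has 60 or borrows 3.
    by_cases ha : ∃ e ∈ dartsAt G d.fst, R.Asks e.symm
    · obtain ⟨e, he, ha⟩ := ha
      have h66 := le_received_of_asks hR ha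
      rw [Dart.symm_symm] at h66
      have hfst : e.fst = d.fst := by simpa using he
      rw [R.received_eq_sum (by rw [hfst, h5]), hfst] at h66
      have := R.sum_loan_symm_le h5
      omega
    · have hl : ∑ e ∈ dartsAt G d.fst, R.loan e.symm = 0 :=
        Finset.sum_eq_zero fun e he => if_neg fun h => ha ⟨e, he, h⟩
      rcases hcases with h60 | ⟨h57, ht, hd⟩
      · omega
      · obtain ⟨e, he, hask⟩ := R.exists_asks h5 ht hd
        have h3 : 3 ≤ ∑ e ∈ dartsAt G d.fst, R.loan e := by
          calc 3 = R.loan e := (if_pos hask).symm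
            _ ≤ _ := Finset.single_le_sum (f := R.loan) (fun _ _ => Nat.zero_le _) (by simpa using he)
        omega
  · have hl : ∑ e ∈ dartsAt G v, R.loan e.symm = 0 :=
      Finset.sum_eq_zero fun e he => if_neg fun h => h5 (by
        rw [← degree_fst_of_mem he]; exact (R.runEnd_of_asks h).1)
    have := sum_giftAlong_le hR h5
    omega

lemma sum_sum_dartsAt {M : Type*} [AddCommMonoid M] (F : G.Dart → M) :
    ∑ v, ∑ e ∈ dartsAt G v, F e = ∑ e, F e :=
  Finset.sum_fiberwise Finset.univ (fun e : G.Dart => e.fst) F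

/-- The total balance of charge. -/
theorem total_balance {R : G.RotationSystem} (hR : R.Avoiding) :
    360 * Fintype.card V ≤ 60 * Fintype.card G.Dart + ∑ e, R.faceGift e := by
  have h := Finset.sum_le_sum fun v (_ : v ∈ Finset.univ) => vertex_balance hR v
  simp only [Finset.sum_add_distrib, sum_sum_dartsAt, ← Finset.mul_sum, Finset.sum_const,
    Finset.card_univ, smul_eq_mul] at h
  -- Every gift and every loan is counted once as given and once as received, so only the initial
  -- charges and the face gifts survive.
  rw [sum_symm R.giftAlong, sum_symm R.loan, ← G.dart_card_eq_sum_degrees] at h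
  omega

end Sums

end RotationSystem

end SimpleGraph

/-! ### Charge of the faces and Euler's formula -/

namespace SimpleGraph

namespace RotationSystem

open MinorStar

variable {V : Type*} {G : SimpleGraph V} (R : G.RotationSystem)

lemma faceNext_ne (d : G.Dart) : R.faceNext d ≠ d := by
  intro h
  have h1 := congrArg (fun e : G.Dart => e.fst) h
  simp only [faceNext_apply, R.rot_fst] at h1
  exact d.snd_ne_fst h1

variable [Fintype V] [DecidableRel G.Adj]

lemma rot_ne (hdeg : ∀ v, 2 ≤ G.degree v) (d : G.Dart) : R.rot d ≠ d := by
  classical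
  intro h
  have h1 := (R.rot_pow_eq_iff d (m := 0) (n := 1)).1 (by simpa using h.symm)
  have h2 := Nat.le_of_dvd (by omega) ((Nat.modEq_iff_dvd' zero_le_one).1 h1)
  have := hdeg d.fst
  omega

lemma faceNext_faceNext_ne (hdeg : ∀ v, 2 ≤ G.degree v) (d : G.Dart) :
    R.faceNext (R.faceNext d) ≠ d := by
  intro h
  apply R.rot_ne hdeg d.symm
  have h1 := congrArg (fun e : G.Dart => e.fst) h
  simp only [faceNext_apply, R.rot_fst] at h1
  have h2 := R.rot_fst d.symm
  exact Dart.ext _ _ (Prod.ext h2 h1)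

section Faces

open Classical in
/-- The darts on a face. -/
noncomputable def faceDarts (q : Quotient (Equiv.Perm.SameCycle.setoid R.faceNext)) :
    Finset G.Dart := {d : G.Dart | Quotient.mk _ d = q}

lemma mem_faceDarts {q : Quotient (Equiv.Perm.SameCycle.setoid R.faceNext)} {d : G.Dart} :
    d ∈ R.faceDarts q ↔ Quotient.mk _ d = q := by
  simp [faceDarts]

lemma faceNext_mem_faceDarts {q : Quotient (Equiv.Perm.SameCycle.setoid R.faceNext)} {d : G.Dart}
    (h : d ∈ R.faceDarts q) : R.faceNext d ∈ R.faceDarts q := by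
  rw [mem_faceDarts] at h ⊢
  rw [← h]
  exact Quotient.sound (Equiv.Perm.sameCycle_apply_left.2 (Equiv.Perm.SameCycle.refl _ _))

/-- A facial walk has at least three darts, and at least four if it is not a triangle. In the second
case `120 * l - 360 ≥ 30 * l`, so the face can give 30 to each corner. -/
lemma face_balance (hdeg : ∀ v, 2 ≤ G.degree v)
    (q : Quotient (Equiv.Perm.SameCycle.setoid R.faceNext)) :
    360 + ∑ d ∈ R.faceDarts q, R.faceGift d ≤ 120 * (R.faceDarts q).card := by
  classical
  by_cases hall : ∀ d ∈ R.faceDarts q, R.Tri d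
  · have h0 : ∑ d ∈ R.faceDarts q, R.faceGift d = 0 :=
      Finset.sum_eq_zero fun d hd => if_pos (hall d hd)
    obtain ⟨d, rfl⟩ := Quotient.exists_rep q
    have m0 : d ∈ R.faceDarts ⟦d⟧ := R.mem_faceDarts.2 rfl
    have m1 := R.faceNext_mem_faceDarts m0
    have m2 := R.faceNext_mem_faceDarts m1
    have hsub : ({d, R.faceNext d, R.faceNext (R.faceNext d)} : Finset G.Dart) ⊆
        R.faceDarts ⟦d⟧ := by
      intro x hx
      simp only [Finset.mem_insert, Finset.mem_singleton] at hx
      rcases hx with rfl | rfl | rfl <;> assumption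
    have hc := Finset.card_le_card hsub
    rw [Finset.card_eq_three.2 ⟨_, _, _, (R.faceNext_ne d).symm,
      (R.faceNext_faceNext_ne hdeg d).symm, (R.faceNext_ne _).symm, rfl⟩] at hc
    omega
  · push Not at hall
    obtain ⟨d, m0, hd⟩ := hall
    have m1 := R.faceNext_mem_faceDarts m0
    have m2 := R.faceNext_mem_faceDarts m1
    have m3 := R.faceNext_mem_faceDarts m2
    have hsub : ({d, R.faceNext d, R.faceNext (R.faceNext d),
        R.faceNext (R.faceNext (R.faceNext d))} : Finset G.Dart) ⊆ R.faceDarts q := by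
      intro x hx
      simp only [Finset.mem_insert, Finset.mem_singleton] at hx
      rcases hx with rfl | rfl | rfl | rfl <;> assumption
    have hc := Finset.card_le_card hsub
    have h4 : ({d, R.faceNext d, R.faceNext (R.faceNext d),
        R.faceNext (R.faceNext (R.faceNext d))} : Finset G.Dart).card = 4 := by
      rw [Finset.card_insert_of_notMem, Finset.card_eq_three.2 ⟨_, _, _, (R.faceNext_ne _).symm,
        (R.faceNext_faceNext_ne hdeg _).symm, (R.faceNext_ne _).symm, rfl⟩]
      simp only [Finset.mem_insert, Finset.mem_singleton, not_or]
      exact ⟨(R.faceNext_ne d).symm, (R.faceNext_faceNext_ne hdeg d).symm, fun h => hd h.symm⟩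
    rw [h4] at hc
    have h30 : ∑ d ∈ R.faceDarts q, R.faceGift d ≤ (R.faceDarts q).card • 30 :=
      Finset.sum_le_card_nsmul _ _ _ fun e _ => by unfold faceGift; split_ifs <;> simp
    rw [smul_eq_mul] at h30
    omega

open Classical in
lemma total_face_balance (hdeg : ∀ v, 2 ≤ G.degree v) :
    360 * Nat.card R.FacialWalk + ∑ d, R.faceGift d ≤ 120 * Fintype.card G.Dart := by
  have hiso : IsEmpty {v : V // ∀ w : V, ¬ G.Adj v w} := by
    refine ⟨fun ⟨v, hv⟩ => ?_⟩
    have : 0 < G.degree v := by have := hdeg v; omega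
    rw [G.degree_pos_iff_exists_adj] at this
    obtain ⟨w, hw⟩ := this
    exact hv w hw
  have hcard : Nat.card R.FacialWalk =
      Fintype.card (Quotient (Equiv.Perm.SameCycle.setoid R.faceNext)) := by
    unfold FacialWalk
    rw [Nat.card_sum, Nat.card_of_isEmpty (α := {v : V // ∀ w : V, ¬ G.Adj v w}), add_zero,
      Nat.card_eq_fintype_card]
  have h := Finset.sum_le_sum fun q (_ : q ∈ Finset.univ) => R.face_balance hdeg q
  rw [Finset.sum_add_distrib, ← Finset.mul_sum, Finset.sum_const, Finset.card_univ,
    smul_eq_mul] at h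
  have h1 : ∑ q, ∑ d ∈ R.faceDarts q, R.faceGift d = ∑ d, R.faceGift d :=
    Finset.sum_fiberwise Finset.univ
      (fun d : G.Dart => Quotient.mk (Equiv.Perm.SameCycle.setoid R.faceNext) d) R.faceGift
  have h2 : ∑ q, (R.faceDarts q).card = Fintype.card G.Dart :=
    (Finset.card_eq_sum_card_fiberwise
      (f := fun d : G.Dart => Quotient.mk (Equiv.Perm.SameCycle.setoid R.faceNext) d)
      (s := Finset.univ) (t := Finset.univ) (by simp)).symm
  rw [h1, h2] at h
  rw [hcard]
  omega

end Faces

/-- Adding the two balances cancels the face gifts and leaves `V + F ≤ E`, while a plane embedding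
has Euler characteristic at least 2. -/
lemma not_isPlane_of_avoiding {R : G.RotationSystem} [Nonempty V] (hR : R.Avoiding) :
    ¬ R.IsPlane := by
  classical
  intro hplane
  have h1 := total_balance hR
  have h2 := R.total_face_balance (fun v => le_trans (by norm_num) (hR.five_le v))
  have h3 := G.dart_card_eq_twice_card_edges
  have h4 : Nat.card G.edgeSet = G.edgeFinset.card := by
    rw [Nat.card_eq_fintype_card, edgeFinset_card]
  have h5 : 0 < Nat.card G.ConnectedComponent := Nat.card_pos
  unfold IsPlane eulerChar at hplane
  rw [h4, Nat.card_eq_fintype_card] at hplane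
  omega

/-! ### From the absence of the seven stars to admissible degree sequences -/

lemma hasMinorFiveStar_iff {κ : Fin 5 → ℕ∞} : R.HasMinorFiveStar κ ↔
    ∃ d : G.Dart, G.degree d.fst = 5 ∧ ((∀ i, (R.star d i : ℕ∞) ≤ κ i) ∨
      (∀ i, (R.mirror.star d i : ℕ∞) ≤ κ i)) := Iff.rfl

lemma forall_le_iff (n : Fin 5 → ℕ) (κ : Fin 5 → ℕ∞) : (∀ i, (n i : ℕ∞) ≤ κ i) ↔
    (n 0 : ℕ∞) ≤ κ 0 ∧ (n 1 : ℕ∞) ≤ κ 1 ∧ (n 2 : ℕ∞) ≤ κ 2 ∧ (n 3 : ℕ∞) ≤ κ 3 ∧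
      (n 4 : ℕ∞) ≤ κ 4 := by
  simp [Fin.forall_fin_succ]

/-- The graph contains one of the seven stars. -/
def HasLightStar : Prop :=
  R.HasMinorFiveStar ![5, 6, 6, 5, ⊤] ∨
  R.HasMinorFiveStar ![5, 6, 6, 6, 17] ∨
  R.HasMinorFiveStar ![6, 6, 6, 6, 11] ∨
  R.HasMinorFiveStar ![5, 6, 9, 5, 10] ∨
  R.HasMinorFiveStar ![5, 6, 11, 5, 9] ∨
  R.HasMinorFiveStar ![5, 5, 10, 5, 12] ∨
  R.HasMinorFiveStar ![5, 5, 9, 5, 17]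

lemma exists_le_of_light {n : Fin 5 → ℕ} (h : Light (n 0) (n 1) (n 2) (n 3) (n 4)) :
    (∀ i, (n i : ℕ∞) ≤ (![5, 6, 6, 5, ⊤] : Fin 5 → ℕ∞) i) ∨
    (∀ i, (n i : ℕ∞) ≤ (![5, 6, 6, 6, 17] : Fin 5 → ℕ∞) i) ∨
    (∀ i, (n i : ℕ∞) ≤ (![6, 6, 6, 6, 11] : Fin 5 → ℕ∞) i) ∨
    (∀ i, (n i : ℕ∞) ≤ (![5, 6, 9, 5, 10] : Fin 5 → ℕ∞) i) ∨
    (∀ i, (n i : ℕ∞) ≤ (![5, 6, 11, 5, 9] : Fin 5 → ℕ∞) i) ∨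
    (∀ i, (n i : ℕ∞) ≤ (![5, 5, 10, 5, 12] : Fin 5 → ℕ∞) i) ∨
    (∀ i, (n i : ℕ∞) ≤ (![5, 5, 9, 5, 17] : Fin 5 → ℕ∞) i) := by
  simp only [forall_le_iff]
  have cast : ∀ a b : ℕ, a ≤ b → (a : ℕ∞) ≤ (b : ℕ∞) := fun a b h => by exact_mod_cast h
  rcases h with ⟨a, b, c, d⟩ | ⟨a, b, c, d, e⟩ | ⟨a, b, c, d, e⟩ | ⟨a, b, c, d, e⟩ |
    ⟨a, b, c, d, e⟩ | ⟨a, b, c, d, e⟩ | ⟨a, b, c, d, e⟩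
  · exact Or.inl ⟨cast _ _ a, cast _ _ b, cast _ _ c, cast _ _ d, le_top⟩
  · exact Or.inr (Or.inl ⟨cast _ _ a, cast _ _ b, cast _ _ c, cast _ _ d, cast _ _ e⟩)
  · exact Or.inr (Or.inr (Or.inl ⟨cast _ _ a, cast _ _ b, cast _ _ c, cast _ _ d, cast _ _ e⟩))
  · exact Or.inr (Or.inr (Or.inr (Or.inl
      ⟨cast _ _ a, cast _ _ b, cast _ _ c, cast _ _ d, cast _ _ e⟩)))
  · exact Or.inr (Or.inr (Or.inr (Or.inr (Or.inl
      ⟨cast _ _ a, cast _ _ b, cast _ _ c, cast _ _ d, cast _ _ e⟩))))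
  · exact Or.inr (Or.inr (Or.inr (Or.inr (Or.inr (Or.inl
      ⟨cast _ _ a, cast _ _ b, cast _ _ c, cast _ _ d, cast _ _ e⟩)))))
  · exact Or.inr (Or.inr (Or.inr (Or.inr (Or.inr (Or.inr
      ⟨cast _ _ a, cast _ _ b, cast _ _ c, cast _ _ d, cast _ _ e⟩)))))

lemma hasLightStar_of_light {d : G.Dart} (h5 : G.degree d.fst = 5)
    (h : Light (R.star d 0) (R.star d 1) (R.star d 2) (R.star d 3) (R.star d 4)) :
    R.HasLightStar := by
  rcases exists_le_of_light h with h | h | h | h | h | h | h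
  · exact Or.inl ⟨d, h5, Or.inl h⟩
  · exact Or.inr (Or.inl ⟨d, h5, Or.inl h⟩)
  · exact Or.inr (Or.inr (Or.inl ⟨d, h5, Or.inl h⟩))
  · exact Or.inr (Or.inr (Or.inr (Or.inl ⟨d, h5, Or.inl h⟩)))
  · exact Or.inr (Or.inr (Or.inr (Or.inr (Or.inl ⟨d, h5, Or.inl h⟩))))
  · exact Or.inr (Or.inr (Or.inr (Or.inr (Or.inr (Or.inl ⟨d, h5, Or.inl h⟩)))))
  · exact Or.inr (Or.inr (Or.inr (Or.inr (Or.inr (Or.inr ⟨d, h5, Or.inl h⟩)))))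

lemma hasMinorFiveStar_mirror {κ : Fin 5 → ℕ∞} (h : R.mirror.HasMinorFiveStar κ) :
    R.HasMinorFiveStar κ := by
  obtain ⟨d, h5, h⟩ := R.mirror.hasMinorFiveStar_iff.1 h
  rw [mirror_mirror] at h
  exact R.hasMinorFiveStar_iff.2 ⟨d, h5, h.symm⟩

lemma hasLightStar_mirror (h : R.mirror.HasLightStar) : R.HasLightStar := by
  have H := fun κ => R.hasMinorFiveStar_mirror (κ := κ)
  exact h.imp (H _) (Or.imp (H _) (Or.imp (H _) (Or.imp (H _) (Or.imp (H _)
    (Or.imp (H _) (H _))))))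

lemma avoiding_of_not_hasLightStar (hmin : ∀ v, 5 ≤ G.degree v)
    (h7 : ∀ v : V, G.degree v ≠ 7) (h8 : ∀ v : V, G.degree v ≠ 8) (h : ¬ R.HasLightStar) :
    R.Avoiding where
  five_le := hmin
  ne_seven := h7
  ne_eight := h8
  admissible d h5 :=
    { five_le := fun _ => hmin _
      ne_seven := fun _ => h7 _
      ne_eight := fun _ => h8 _
      not_light := fun i hl => by
        have h5' : G.degree ((R.rot ^ (i : ℕ)) d).fst = 5 := by rw [R.rot_pow_fst, h5]
        refine h (R.hasLightStar_of_light h5' ?_)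
        rw [R.star_rot_pow h5]
        simpa only [shift, add_comm _ i, add_zero] using hl
      not_light' := fun i hl => by
        have h5' : G.degree ((R.rot ^ (i : ℕ)) d).fst = 5 := by rw [R.rot_pow_fst, h5]
        refine h (R.hasLightStar_mirror (R.mirror.hasLightStar_of_light h5' ?_))
        simp only [R.mirror_star h5']
        rw [R.star_rot_pow h5]
        simpa [shift, add_comm _ i, show (-1 : Fin 5) = 4 from rfl,
          show (-2 : Fin 5) = 3 from rfl, show (-3 : Fin 5) = 2 from rfl,
          show (-4 : Fin 5) = 1 from rfl] using hl }

end RotationSystem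

end SimpleGraph

theorem theorem8 {V : Type*} [Fintype V] (G : SimpleGraph V) [DecidableRel G.Adj]
    (R : G.RotationSystem) (hplane : R.IsPlane) (hmin : G.minDegree = 5)
    (h7 : ∀ v : V, G.degree v ≠ 7) (h8 : ∀ v : V, G.degree v ≠ 8) :
    R.HasMinorFiveStar ![5, 6, 6, 5, ⊤] ∨
    R.HasMinorFiveStar ![5, 6, 6, 6, 17] ∨
    R.HasMinorFiveStar ![6, 6, 6, 6, 11] ∨
    R.HasMinorFiveStar ![5, 6, 9, 5, 10] ∨
    R.HasMinorFiveStar ![5, 6, 11, 5, 9] ∨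
    R.HasMinorFiveStar ![5, 5, 10, 5, 12] ∨
    R.HasMinorFiveStar ![5, 5, 9, 5, 17] := by
  -- The minimum degree of the empty graph is 0 by convention, so the hypothesis excludes it.
  have hV : Nonempty V := by
    by_contra hV
    rw [not_nonempty_iff] at hV
    simp [SimpleGraph.minDegree] at hmin
  by_contra h
  exact SimpleGraph.RotationSystem.not_isPlane_of_avoiding
    (R.avoiding_of_not_hasLightStar (fun v => hmin ▸ G.minDegree_le_degree v) h7 h8 h) hplane
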